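/- Let $K,L,M,P\ge 1$ with $K\le M$, and put $N=M+P-1$. Let $f_1,\dots,f_K\in[0,1)$ be distinct; for $n\ge1$ let $A_n$ be the $n\times K$ Vandermonde matrix with $(m,k)$ entry $e^{2\pi i (m-1)f_k}$, and $A=A_N$. Let $S\in\mathbb C^{K\times L}$ be a fixed matrix, and let $Y=AS+E$, where the entries of the random $N\times L$ matrix $E$ are i.i.d. (circularly symmetric) complex Gaussian with mean zero and variance $\sigma^2$, $\sigma\ge0$. Put $\widehat\Sigma=\frac1L SS^H$, $C_P=\frac1P\overline{A_P^HA_P}$ and $\widehat\Sigma_{SS}=\widehat\Sigma\odot C_P$ (Hadamard product). For an $N\times L$ matrix $X$ let $X_{(p)}$, $p=1,\dots,P$, be the $M\times L$ submatrix of rows $p,\dots,p+M-1$. Let $\widehat U\in\mathbb C^{M\times K}$ consist of the first $K$ orthonormal eigenvectors (eigenvalues sorted in descending order) of $\frac1{PL}\sum_{p=1}^P Y_{(p)}Y_{(p)}^H$, and let $U\in\mathbb C^{M\times K}$ consist of those of the noise-free matrix $\frac1{PL}\sum_{p=1}^P (AS)_{(p)}(AS)_{(p)}^H$, that is, of the first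 $K$ left singular vectors of $[(AS)_{(1)},\dots,(AS)_{(P)}]$. Let $\operatorname{dist}(\widehat U,U)=\|\sin\Theta(\widehat U,U)\|$, where $\Theta$ is the diagonal matrix of the canonical angles $\theta_j=\arccos\sigma_j(\widehat U^HU)$. Here $\|\cdot\|$ is the spectral norm and $\sigma_j$, $\lambda_j$ denote the $j$-th greatest singular value and eigenvalue. If $\widehat\Sigma_{SS}$ is positive definite and $$B:=\frac{12\sigma\|A_M\|\,\|\widehat\Sigma\|^{1/2}\sqrt{M/L}+16\sigma^2\max\{\sqrt{M/L},\,M/L\}}{\sigma_K^2(A_M)\,\lambda_K(\widehat\Sigma_{SS})}<0.586,$$ then, with probability at least $1-3Pe^{-M/2}$, $\operatorname{dist}(\widehat U,U)\le B$ (for every choice of the eigenvectors). -/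

import Mathlib

open MeasureTheory ProbabilityTheory
open scoped Matrix Matrix.Norms.L2Operator ComplexOrder

namespace SpatialSmoothing

noncomputable section

/-- The `j`-th greatest singular value of a complex matrix, counted from `j = 0`. -/
def singularValue {m n : ℕ} (A : Matrix (Fin m) (Fin n) ℂ) (j : ℕ) : ℝ :=
  (Matrix.toEuclideanLin A).singularValues j

/-- The `j`-th greatest eigenvalue (with multiplicity) of a Hermitian matrix, counted from
`j = 0`. -/
def sortedEigenvalue {n : ℕ} {A : Matrix (Fin n) (Fin n) ℂ} (hA : A.IsHermitian)
    (j : Fin n) : ℝ :=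
  hA.eigenvalues₀ (Fin.cast (Fintype.card_fin n).symm j)

/-- The centred circularly symmetric complex Gaussian distribution with variance `v`: real and
imaginary part are independent real Gaussians with mean `0` and variance `v / 2`. -/
def complexGaussian (v : ℝ) : Measure ℂ :=
  ((gaussianReal 0 (v / 2).toNNReal).prod (gaussianReal 0 (v / 2).toNNReal)).map
    Complex.measurableEquivRealProd.symm

/-- The `n × K` Vandermonde (array manifold) matrix with `(m, k)` entry `exp (2 π i m f_k)`, the
rows being counted from `m = 0`. -/
def steering {K : ℕ} (f : Fin K → ℝ) (n : ℕ) : Matrix (Fin n) (Fin K) ℂ :=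
  Matrix.of fun m k => Complex.exp (2 * Real.pi * Complex.I * (m : ℕ) * (f k : ℂ))

/-- The sample covariance `(1 / L) S Sᴴ` of the `K × L` source signal matrix `S`. -/
def sourceCov {K L : ℕ} (S : Matrix (Fin K) (Fin L) ℂ) : Matrix (Fin K) (Fin K) ℂ :=
  (1 / (L : ℂ)) • (S * Sᴴ)

/-- The correlation matrix `C_P`, the complex conjugate of `(1 / P) A_Pᴴ A_P`. -/
def corr {K : ℕ} (f : Fin K → ℝ) (P : ℕ) : Matrix (Fin K) (Fin K) ℂ :=
  (1 / (P : ℂ)) • ((steering f P)ᴴ * steering f P).map (starRingEnd ℂ)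

/-- The smoothed sample source covariance: the Hadamard product of the sample source covariance
and `C_P`. -/
def smoothedSourceCov {K L : ℕ} (f : Fin K → ℝ) (P : ℕ) (S : Matrix (Fin K) (Fin L) ℂ) :
    Matrix (Fin K) (Fin K) ℂ :=
  sourceCov S ⊙ corr f P

/-- The data of the `p`-th of the `P = N - M + 1` subarrays: `M` consecutive rows of `Y`, starting
from row `p` (rows and subarrays are counted from `0`). -/
def subarray {N M P L : ℕ} (hN : N + 1 = M + P) (Y : Matrix (Fin N) (Fin L) ℂ) (p : Fin P) :
    Matrix (Fin M) (Fin L) ℂ :=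
  Matrix.of fun m l => Y ⟨(p : ℕ) + (m : ℕ), by omega⟩ l

/-- The forward-only smoothed sample covariance of the data matrix `Y`:
the average over the subarrays of `(1 / L) Y_p Y_pᴴ`. -/
def smoothedCov {N M P L : ℕ} (hN : N + 1 = M + P) (Y : Matrix (Fin N) (Fin L) ℂ) :
    Matrix (Fin M) (Fin M) ℂ :=
  (1 / (P : ℂ)) • ∑ p : Fin P, (1 / (L : ℂ)) • (subarray hN Y p * (subarray hN Y p)ᴴ)

/-- The columns of `U` are the first `K` eigenvectors in some eigen-decomposition
`R = V diag(ev) Vᴴ` with `V` unitary and the eigenvalues `ev` sorted in descending order. -/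
def IsLeadingEigenvectors {M K : ℕ} (hKM : K ≤ M) (R : Matrix (Fin M) (Fin M) ℂ)
    (U : Matrix (Fin M) (Fin K) ℂ) : Prop :=
  ∃ V ∈ Matrix.unitaryGroup (Fin M) ℂ, ∃ ev : Fin M → ℝ, Antitone ev ∧
    R = V * Matrix.diagonal (fun j => (ev j : ℂ)) * Vᴴ ∧
    ∀ m k, U m k = V m (Fin.castLE hKM k)

/-- The `j`-th canonical angle between the column spaces of two matrices with orthonormal
columns. -/
def canonicalAngle {M K : ℕ} (U₁ U₂ : Matrix (Fin M) (Fin K) ℂ) (j : Fin K) : ℝ :=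
  Real.arccos (singularValue (U₁ᴴ * U₂) j)

/-- The distance between the column spaces of two matrices with orthonormal columns: the spectral
norm of the diagonal matrix of the sines of the canonical angles. -/
def subspaceDist {M K : ℕ} (U₁ U₂ : Matrix (Fin M) (Fin K) ℂ) : ℝ :=
  ‖Matrix.diagonal fun j : Fin K => Real.sin (canonicalAngle U₁ U₂ j)‖

/-- The error bound for forward-only spatial smoothing; all matrix norms are spectral norms. -/
def errorBound {K L : ℕ} (hK : 0 < K) (f : Fin K → ℝ) (S : Matrix (Fin K) (Fin L) ℂ) (σ : ℝ)
    (M P : ℕ) (hS : (smoothedSourceCov f P S).PosDef) : ℝ :=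
  (12 * σ * ‖steering f M‖ * √‖sourceCov S‖ * √((M : ℝ) / L)
      + 16 * σ ^ 2 * max (√((M : ℝ) / L)) ((M : ℝ) / L))
    / (singularValue (steering f M) (K - 1) ^ 2
      * sortedEigenvalue hS.isHermitian ⟨K - 1, Nat.sub_lt hK one_pos⟩)

end

end SpatialSmoothing

open SpatialSmoothing

open scoped ENNReal NNReal RealInnerProductSpace ComplexConjugate

/-! ### Complex Gaussian variables: exponential moments, linear combinations, independent columns.
-/

section ComplexGaussian

/-! Subarray `p` of the noise-free data sees the sources multiplied by a diagonal matrix of phases,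
so smoothing gives exactly `R = A_M Σ_SS A_Mᴴ` (`smoothedCov_steering_mul`). Its first `K`
eigenvalues are at least `g = σ_K(A_M)² λ_K(Σ_SS) > 0`. The noisy covariance is `R + σ² I + Δ`, and
the multiple of the identity does not move eigenvectors. If `‖Δ‖ ≤ T < g`, the trailing eigenvalues
of the noisy matrix lie within `T` of `σ²`, and a Davis-Kahan argument
(`norm_trailingLeadingBlock_mul_le`, `subspaceDist_mul_le`) yields `dist * (g - T) ≤ T`.

`Δ` averages, over the subarrays, a cross term linear in the noise and a centred noise covariance.
The subarrays overlap and are dependent, so each is treated alone, failing with probability at most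
`3 exp(-M/2)` (one part for the cross term, two for the noise), and a union bound gives the factor
`P`.

The tail of a random Hermitian `W` is obtained by a volume argument instead of a net: the integral
of `exp(s yᴴ W y)` over the unit ball dominates `exp(4/5 |s| ‖W‖)` times the volume of a ball of
radius `1/10`, for the right sign of `s`. Fubini and Markov then reduce the tail to exponential
moments at a fixed `y`, where the Gaussian law is explicit
(`measure_lt_norm_le_of_lintegral_exp_hermForm_le`).

The constants give `T = 5/8 B g`. As `B < 0.586 < 3/5`, the remaining gap `g - T` is at least `5/8
g`, whence `dist ≤ B`. -/

instance isProbabilityMeasure_complexGaussian (v : ℝ) :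
    IsProbabilityMeasure (complexGaussian v) := by
  unfold complexGaussian
  exact Measure.isProbabilityMeasure_map
    Complex.measurableEquivRealProd.symm.measurable.aemeasurable

theorem complexGaussian_zero : complexGaussian 0 = Measure.dirac 0 := by
  simp only [complexGaussian, zero_div, Real.toNNReal_zero, gaussianReal_zero_var]
  rw [Measure.dirac_prod_dirac, Measure.map_dirac' Complex.measurableEquivRealProd.symm.measurable]
  congr 1

theorem lintegral_complexGaussian_mul {v : ℝ} {g h : ℝ → ℝ≥0∞} (hg : Measurable g)
    (hh : Measurable h) :
    ∫⁻ z, g z.re * h z.im ∂complexGaussian v =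
      (∫⁻ x, g x ∂gaussianReal 0 (v / 2).toNNReal) *
        ∫⁻ x, h x ∂gaussianReal 0 (v / 2).toNNReal := by
  unfold complexGaussian
  rw [MeasureTheory.lintegral_map_equiv, ← lintegral_prod_mul hg.aemeasurable hh.aemeasurable]
  rfl

theorem charFun_complexGaussian {v : ℝ} (hv : 0 ≤ v) (t : ℂ) :
    charFun (complexGaussian v) t = Complex.exp (-(v * ‖t‖ ^ 2 / 4 : ℝ)) := by
  have h (s : ℝ) : ∫ x, Complex.exp (((x * s : ℝ) : ℂ) * Complex.I)
      ∂gaussianReal 0 (v / 2).toNNReal = Complex.exp (-(v * s ^ 2 / 4 : ℝ)) := by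
    have := charFun_gaussianReal (μ := 0) (v := (v / 2).toNNReal) s
    rw [charFun_apply_real] at this
    rw [show (fun x : ℝ => Complex.exp (((x * s : ℝ) : ℂ) * Complex.I)) =
      fun x : ℝ => Complex.exp (s * x * Complex.I) by ext x; push_cast; ring_nf, this]
    congr 1
    have : (((v / 2).toNNReal : ℝ≥0) : ℂ) = (v / 2 : ℝ) := by
      rw [← Complex.ofReal_inj.mpr (Real.coe_toNNReal (v / 2) (by positivity))]
    rw [this]
    push_cast
    ring
  rw [charFun_apply]
  unfold complexGaussian
  rw [MeasureTheory.integral_map_equiv]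
  have e : ∀ p : ℝ × ℝ, Complex.exp
      ((⟪Complex.measurableEquivRealProd.symm p, t⟫ : ℝ) * Complex.I) =
      Complex.exp (((p.1 * t.re : ℝ) : ℂ) * Complex.I) *
        Complex.exp (((p.2 * t.im : ℝ) : ℂ) * Complex.I) := by
    intro p
    rw [← Complex.exp_add, Complex.inner]
    congr 1
    have : (t * conj (Complex.measurableEquivRealProd.symm p)).re
        = p.1 * t.re + p.2 * t.im := by
      simp [Complex.measurableEquivRealProd, mul_comm]
    rw [this]
    push_cast
    ring
  simp_rw [e]
  rw [integral_prod_mul (fun x : ℝ => Complex.exp (((x * t.re : ℝ) : ℂ) * Complex.I))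
    (fun x : ℝ => Complex.exp (((x * t.im : ℝ) : ℂ) * Complex.I)), h, h, ← Complex.exp_add,
    ← Complex.normSq_eq_norm_sq, Complex.normSq_apply]
  congr 1
  push_cast
  ring

theorem lintegral_exp_mul_gaussianReal (w : ℝ≥0) (t : ℝ) :
    ∫⁻ x, ENNReal.ofReal (Real.exp (t * x)) ∂gaussianReal 0 w =
      ENNReal.ofReal (Real.exp (w * t ^ 2 / 2)) := by
  rw [← ofReal_integral_eq_lintegral_ofReal (integrable_exp_mul_gaussianReal t)
    (Filter.Eventually.of_forall fun x => (Real.exp_pos _).le)]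
  have := congrFun (mgf_id_gaussianReal (μ := 0) (v := w)) t
  simp only [mgf, id, zero_mul, zero_add] at this
  rw [this]

theorem lintegral_exp_mul_sq_gaussianReal {w : ℝ≥0} {s : ℝ} (hs : 2 * s * w < 1) :
    ∫⁻ x, ENNReal.ofReal (Real.exp (s * x ^ 2)) ∂gaussianReal 0 w =
      ENNReal.ofReal (√(1 - 2 * s * w))⁻¹ := by
  rcases eq_or_ne w 0 with rfl | hw
  · simp [gaussianReal_zero_var]
  have hw' : (0 : ℝ) < w := by positivity
  have hpos : 0 < 1 - 2 * s * w := by linarith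
  -- Tilting the density by `exp(s x²)` gives, up to a constant, the Gaussian density of this
  -- variance.
  set w' : ℝ≥0 := ⟨w / (1 - 2 * s * w), by positivity⟩ with hw'def
  have hw'c : (w' : ℝ) = w / (1 - 2 * s * w) := rfl
  have hw'0 : w' ≠ 0 := by
    have : (0 : ℝ) < w' := by rw [hw'c]; positivity
    exact fun h => by simp [h] at this
  rw [gaussianReal_of_var_ne_zero 0 hw, lintegral_withDensity_eq_lintegral_mul _
    (measurable_gaussianPDF 0 w) (by fun_prop)]
  have key : ∀ x : ℝ, (gaussianPDF 0 w * fun x => ENNReal.ofReal (Real.exp (s * x ^ 2))) x =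
      ENNReal.ofReal (√(1 - 2 * s * w))⁻¹ * gaussianPDF 0 w' x := by
    intro x
    simp only [Pi.mul_apply, gaussianPDF]
    rw [← ENNReal.ofReal_mul (gaussianPDFReal_nonneg _ _ _), ← ENNReal.ofReal_mul (by positivity)]
    congr 1
    simp only [gaussianPDFReal, hw'c]
    rw [mul_assoc, ← Real.exp_add, ← mul_assoc]
    congr 1
    · rw [← mul_inv, ← Real.sqrt_mul hpos.le]
      congr 2
      have hne := hpos.ne'
      generalize 1 - 2 * s * (w : ℝ) = d at hne
      field_simp
    · congr 1
      field_simp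
      ring
  rw [lintegral_congr key, lintegral_const_mul _ (measurable_gaussianPDF 0 w'),
    lintegral_gaussianPDF_eq_one 0 hw'0, mul_one]

theorem lintegral_exp_mul_normSq_complexGaussian {v s : ℝ} (hv : 0 ≤ v) (hs : s * v < 1) :
    ∫⁻ z, ENNReal.ofReal (Real.exp (s * ‖z‖ ^ 2)) ∂complexGaussian v =
      ENNReal.ofReal (1 - s * v)⁻¹ := by
  have hc : (((v / 2).toNNReal : ℝ≥0) : ℝ) = v / 2 := Real.coe_toNNReal _ (by positivity)
  have e : ∀ z : ℂ, ENNReal.ofReal (Real.exp (s * ‖z‖ ^ 2)) =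
      ENNReal.ofReal (Real.exp (s * z.re ^ 2)) * ENNReal.ofReal (Real.exp (s * z.im ^ 2)) := by
    intro z
    rw [← ENNReal.ofReal_mul (Real.exp_pos _).le, ← Real.exp_add, ← Complex.normSq_eq_norm_sq,
      Complex.normSq_apply]
    ring_nf
  rw [lintegral_congr e, lintegral_complexGaussian_mul
    (g := fun x => ENNReal.ofReal (Real.exp (s * x ^ 2)))
    (h := fun x => ENNReal.ofReal (Real.exp (s * x ^ 2))) (by fun_prop) (by fun_prop),
    lintegral_exp_mul_sq_gaussianReal (by rw [hc]; linarith), hc,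
    ← ENNReal.ofReal_mul (by positivity), ← mul_inv, Real.mul_self_sqrt (by linarith)]
  ring_nf

theorem lintegral_exp_re_complexGaussian {v : ℝ} (hv : 0 ≤ v) (b : ℂ) :
    ∫⁻ z, ENNReal.ofReal (Real.exp (2 * (conj b * z).re)) ∂complexGaussian v =
      ENNReal.ofReal (Real.exp (‖b‖ ^ 2 * v)) := by
  have hc : (((v / 2).toNNReal : ℝ≥0) : ℝ) = v / 2 := Real.coe_toNNReal _ (by positivity)
  have e : ∀ z : ℂ, ENNReal.ofReal (Real.exp (2 * (conj b * z).re)) =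
      ENNReal.ofReal (Real.exp ((2 * b.re) * z.re)) *
        ENNReal.ofReal (Real.exp ((2 * b.im) * z.im)) := by
    intro z
    rw [← ENNReal.ofReal_mul (Real.exp_pos _).le, ← Real.exp_add]
    simp only [Complex.mul_re, Complex.conj_re, Complex.conj_im]
    ring_nf
  rw [lintegral_congr e, lintegral_complexGaussian_mul
    (g := fun x => ENNReal.ofReal (Real.exp ((2 * b.re) * x)))
    (h := fun x => ENNReal.ofReal (Real.exp ((2 * b.im) * x))) (by fun_prop) (by fun_prop),
    lintegral_exp_mul_gaussianReal, lintegral_exp_mul_gaussianReal, hc,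
    ← ENNReal.ofReal_mul (by positivity), ← Real.exp_add, ← Complex.normSq_eq_norm_sq,
    Complex.normSq_apply]
  ring_nf

variable {Ω : Type*} [MeasurableSpace Ω] {μ : Measure Ω}

/-- Characteristic functions multiply, and that of a circular Gaussian depends only on `‖t‖`, so
conjugation and the phases of `y` are invisible. -/
theorem hasLaw_sum_conj_mul [IsProbabilityMeasure μ] {ι : Type*} [Fintype ι] {v : ℝ} (hv : 0 ≤ v)
    {X : ι → Ω → ℂ} (hX : iIndepFun X μ) (hlaw : ∀ i, HasLaw (X i) (complexGaussian v) μ)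
    (y : ι → ℂ) :
    HasLaw (fun ω => ∑ i, conj (X i ω) * y i) (complexGaussian (v * ∑ i, ‖y i‖ ^ 2)) μ := by
  have hm : ∀ i, AEMeasurable (fun ω => conj (X i ω) * y i) μ := fun i =>
    ((by fun_prop : Measurable fun z : ℂ => conj z * y i)).comp_aemeasurable (hlaw i).aemeasurable
  refine ⟨Finset.aemeasurable_fun_sum _ fun i _ => hm i, ?_⟩
  apply Measure.ext_of_charFun
  have hind : iIndepFun (fun i ω => conj (X i ω) * y i) μ :=
    hX.comp (fun i z => conj z * y i) (fun i => by fun_prop)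
  rw [hind.charFun_map_fun_sum_eq_prod hm]
  ext t
  have h1 : ∀ i, charFun (μ.map fun ω => conj (X i ω) * y i) t =
      Complex.exp (-(v * (‖y i‖ ^ 2 * ‖t‖ ^ 2) / 4 : ℝ)) := by
    intro i
    have : μ.map (fun ω => conj (X i ω) * y i) =
        (complexGaussian v).map (fun z : ℂ => conj z * y i) := by
      rw [← (hlaw i).map_eq, AEMeasurable.map_map_of_aemeasurable (by fun_prop)
        (hlaw i).aemeasurable]
      rfl
    rw [this, charFun_apply, integral_map (by fun_prop) (by fun_prop)]
    have e : ∀ z : ℂ, (⟪conj z * y i, t⟫ : ℝ) = ⟪z, y i * conj t⟫ := by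
      intro z
      simp only [Complex.inner, map_mul, Complex.conj_conj, Complex.mul_re, Complex.mul_im,
        Complex.conj_re, Complex.conj_im]
      ring
    simp_rw [e]
    rw [← charFun_apply, charFun_complexGaussian hv, norm_mul, RCLike.norm_conj, mul_pow]
  rw [Finset.prod_apply, Finset.prod_congr rfl fun i _ => h1 i, ← Complex.exp_sum,
    charFun_complexGaussian (by positivity)]
  congr 1
  push_cast
  rw [Finset.sum_neg_distrib, Finset.mul_sum, Finset.sum_mul, Finset.sum_div]
  congr 1
  exact Finset.sum_congr rfl fun i _ => by ring

/-- The coordinates of the iterated product measure are themselves i.i.d. with law `ν`. Hence the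
law of the columns and the iterated product are both images of the same flat product measure under
currying. -/
theorem iIndepFun.columns [IsProbabilityMeasure μ] {ι κ 𝓧 : Type*} [Fintype ι] [Fintype κ]
    [MeasurableSpace 𝓧] {X : ι → κ → Ω → 𝓧} {ν : Measure 𝓧} [IsProbabilityMeasure ν]
    (hX : iIndepFun (fun p : ι × κ => X p.1 p.2) μ) (hlaw : ∀ i k, HasLaw (X i k) ν μ) :
    iIndepFun (fun k ω i => X i k ω) μ := by
  have hc : ∀ k, iIndepFun (fun i => X i k) μ := fun k =>
    hX.precomp (g := fun i => (i, k)) (fun a b h => (Prod.mk.inj h).1)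
  have hcol : ∀ k, HasLaw (fun ω i => X i k ω) (Measure.pi fun _ : ι => ν) μ := fun k =>
    (hc k).hasLaw_pi fun i => hlaw i k
  rw [iIndepFun_iff_hasLaw_pi_pi hcol]
  refine ⟨aemeasurable_pi_lambda _ fun k => (hcol k).aemeasurable, ?_⟩
  set N : Measure (κ → ι → 𝓧) := Measure.pi fun _ => Measure.pi fun _ => ν with hN
  have hlaw1 : HasLaw (fun ω (p : ι × κ) => X p.1 p.2 ω) (Measure.pi fun _ : ι × κ => ν) μ :=
    hX.hasLaw_pi fun p => hlaw p.1 p.2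
  have hcoord : ∀ k i, HasLaw (fun x : κ → ι → 𝓧 => x k i) ν N := fun k i => by
    have h1 : MeasurePreserving (fun x : κ → ι → 𝓧 => x k) N (Measure.pi fun _ => ν) :=
      measurePreserving_eval (fun _ => Measure.pi fun _ : ι => ν) k
    have h2 : MeasurePreserving (fun x : ι → 𝓧 => x i) (Measure.pi fun _ => ν) ν :=
      measurePreserving_eval (fun _ => ν) i
    exact (h2.comp h1).hasLaw
  have hindN : iIndepFun (fun (p : κ × ι) (x : κ → ι → 𝓧) => x p.1 p.2) N := by
    refine iIndepFun_uncurry' (X := fun k i (x : κ → ι → 𝓧) => x k i) (by fun_prop) ?_ ?_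
    · exact iIndepFun_pi (X := fun (_ : κ) (y : ι → 𝓧) => y) (fun _ => aemeasurable_id)
    · intro k
      rw [iIndepFun_iff_hasLaw_pi_pi (fun i => hcoord k i)]
      exact (measurePreserving_eval (fun _ => Measure.pi fun _ : ι => ν) k).hasLaw
  have hlaw2 : HasLaw (fun (x : κ → ι → 𝓧) (p : ι × κ) => x p.2 p.1)
      (Measure.pi fun _ : ι × κ => ν) N :=
    (hindN.precomp (g := Prod.swap) Prod.swap_injective).hasLaw_pi fun p => hcoord p.2 p.1
  have hcurry : Measurable fun (z : ι × κ → 𝓧) (k : κ) (i : ι) => z (i, k) := by fun_prop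
  have e1 := AEMeasurable.map_map_of_aemeasurable hcurry.aemeasurable hlaw1.aemeasurable
  have e2 := AEMeasurable.map_map_of_aemeasurable hcurry.aemeasurable hlaw2.aemeasurable
  rw [hlaw1.map_eq] at e1
  rw [hlaw2.map_eq, e1] at e2
  rw [show (fun ω k i => X i k ω) = (fun (z : ι × κ → 𝓧) (k : κ) (i : ι) => z (i, k)) ∘
    (fun ω (p : ι × κ) => X p.1 p.2 ω) from rfl, e2]
  exact Measure.map_id

end ComplexGaussian

/-! ### Norm tails of random Hermitian matrices by integration over the unit ball. -/

section HermitianForm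

variable {M : ℕ}

/-- The real part of the sesquilinear form `yᴴ W y`. -/
noncomputable def hermForm (W : Matrix (Fin M) (Fin M) ℂ) (y : EuclideanSpace ℂ (Fin M)) : ℝ :=
  (star y.ofLp ⬝ᵥ W *ᵥ y.ofLp).re

theorem hermForm_eq_inner (W : Matrix (Fin M) (Fin M) ℂ) (y : EuclideanSpace ℂ (Fin M)) :
    hermForm W y = (inner ℂ y (WithLp.toLp 2 (W *ᵥ y.ofLp))).re := by
  rw [EuclideanSpace.inner_eq_star_dotProduct, dotProduct_comm]
  rfl

theorem abs_hermForm_le (W : Matrix (Fin M) (Fin M) ℂ) (y : EuclideanSpace ℂ (Fin M)) :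
    |hermForm W y| ≤ ‖W‖ * ‖y‖ ^ 2 := by
  rw [hermForm_eq_inner]
  calc _ ≤ ‖inner ℂ y (WithLp.toLp 2 (W *ᵥ y.ofLp))‖ := Complex.abs_re_le_norm _
    _ ≤ ‖y‖ * ‖WithLp.toLp 2 (W *ᵥ y.ofLp)‖ := norm_inner_le_norm _ _
    _ ≤ ‖y‖ * (‖W‖ * ‖y‖) := by gcongr; exact Matrix.l2_opNorm_mulVec W y
    _ = ‖W‖ * ‖y‖ ^ 2 := by ring

theorem hermForm_add_add_hermForm_sub (W : Matrix (Fin M) (Fin M) ℂ) (a : ℝ)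
    (v z : EuclideanSpace ℂ (Fin M)) :
    hermForm W (a • v + z) + hermForm W (a • v - z) = 2 * (a ^ 2 * hermForm W v + hermForm W z) := by
  have h : ∀ x y : Fin M → ℂ, star (a • x + y) ⬝ᵥ W *ᵥ (a • x + y) +
      star (a • x - y) ⬝ᵥ W *ᵥ (a • x - y) =
      2 * (((a ^ 2 : ℝ) : ℂ) * (star x ⬝ᵥ W *ᵥ x) + star y ⬝ᵥ W *ᵥ y) := by
    intro x y
    have h1 : star (a • x) = (a : ℂ) • star x := by ext i; simp
    have h2 : W *ᵥ (a • x) = (a : ℂ) • (W *ᵥ x) := by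
      rw [← Matrix.mulVec_smul]; rfl
    simp only [star_add, star_sub, Matrix.mulVec_add, Matrix.mulVec_sub, add_dotProduct,
      sub_dotProduct, dotProduct_add, dotProduct_sub, h1, h2, smul_dotProduct, dotProduct_smul,
      smul_eq_mul]
    push_cast
    ring
  have := congrArg Complex.re (h v.ofLp z.ofLp)
  simp only [Complex.add_re, Complex.mul_re, Complex.ofReal_re, Complex.ofReal_im, zero_mul,
    sub_zero, Complex.re_ofNat, Complex.im_ofNat] at this
  exact this

theorem exists_abs_hermForm_eq_norm (hM : 0 < M) {W : Matrix (Fin M) (Fin M) ℂ}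
    (hW : W.IsHermitian) : ∃ v : EuclideanSpace ℂ (Fin M), ‖v‖ = 1 ∧ |hermForm W v| = ‖W‖ := by
  have : Nonempty (Fin M) := ⟨⟨0, hM⟩⟩
  have hn : ‖W‖ = ‖hW.eigenvalues‖ := by
    conv_lhs => rw [hW.spectral_theorem]
    rw [Unitary.conjStarAlgAut_apply,
      CStarRing.norm_mul_mem_unitary _ (Unitary.star_mem hW.eigenvectorUnitary.2),
      CStarRing.norm_coe_unitary_mul, Matrix.l2_opNorm_diagonal]
    simp only [Pi.norm_def, Function.comp_def]
    congr 2
    ext i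
    simp
  obtain ⟨i, -, hmax⟩ := Finset.exists_max_image Finset.univ (fun i => ‖hW.eigenvalues i‖)
    Finset.univ_nonempty
  have hi : ‖hW.eigenvalues i‖ = ‖hW.eigenvalues‖ :=
    le_antisymm (norm_le_pi_norm _ i) ((pi_norm_le_iff_of_nonneg (norm_nonneg _)).mpr
      fun j => hmax j (Finset.mem_univ j))
  refine ⟨hW.eigenvectorBasis i, hW.eigenvectorBasis.orthonormal.1 i, ?_⟩
  rw [hn, ← hi, hermForm, hW.mulVec_eigenvectorBasis i, dotProduct_smul]
  have h1 : star (hW.eigenvectorBasis i).ofLp ⬝ᵥ (hW.eigenvectorBasis i).ofLp = 1 := by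
    rw [dotProduct_comm, ← EuclideanSpace.inner_eq_star_dotProduct,
      inner_self_eq_norm_sq_to_K, hW.eigenvectorBasis.orthonormal.1 i]
    simp
  rw [h1]
  simp

open Metric in
-- Only a small ball about `c = 9/10 v` is kept, with `v` a norming vector. Averaging over `c + z`
-- and `c - z` cancels the terms linear in `z`, leaving an exponent of at least `(0.81 - 0.01) |s|
-- ‖W‖`.
theorem ofReal_exp_mul_measure_ball_le_lintegral {W : Matrix (Fin M) (Fin M) ℂ}
    (ν : Measure (EuclideanSpace ℂ (Fin M))) [ν.IsAddHaarMeasure] {s : ℝ}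
    {v : EuclideanSpace ℂ (Fin M)} (hv : ‖v‖ = 1) (hs : s * hermForm W v = |s| * ‖W‖) :
    ENNReal.ofReal (Real.exp (4 / 5 * (|s| * ‖W‖))) * ν (ball 0 (1 / 10)) ≤
      ∫⁻ y in ball 0 1, ENNReal.ofReal (Real.exp (s * hermForm W y)) ∂ν := by
  set h : EuclideanSpace ℂ (Fin M) → ℝ≥0∞ :=
    fun y => ENNReal.ofReal (Real.exp (s * hermForm W y)) with hh
  have hmeas : Measurable h := by
    simp only [hh, hermForm, dotProduct, Matrix.mulVec]
    fun_prop
  set c : EuclideanSpace ℂ (Fin M) := (9 / 10 : ℝ) • v with hc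
  have hcn : ‖c‖ = 9 / 10 := by rw [hc, norm_smul, hv]; norm_num
  set A := ∫⁻ y in ball c (1 / 10), h y ∂ν with hA
  have hAle : A ≤ ∫⁻ y in ball 0 1, h y ∂ν := by
    refine lintegral_mono_set (ball_subset_ball' ?_)
    rw [dist_zero_right, hcn]
    norm_num
  have hadd : A = ∫⁻ z in ball 0 (1 / 10), h (c + z) ∂ν := by
    rw [hA, ← lintegral_indicator measurableSet_ball, ← lintegral_indicator measurableSet_ball,
      ← lintegral_add_left_eq_self _ c]
    refine lintegral_congr fun z => ?_
    simp [Set.indicator, mem_ball, dist_eq_norm]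
  have hsub : A = ∫⁻ z in ball 0 (1 / 10), h (c - z) ∂ν := by
    rw [hA, ← lintegral_indicator measurableSet_ball, ← lintegral_indicator measurableSet_ball,
      ← lintegral_sub_left_eq_self _ c]
    refine lintegral_congr fun z => ?_
    simp [Set.indicator, mem_ball, dist_eq_norm]
  have hpt : ∀ z ∈ ball (0 : EuclideanSpace ℂ (Fin M)) (1 / 10),
      2 * ENNReal.ofReal (Real.exp (4 / 5 * (|s| * ‖W‖))) ≤ h (c + z) + h (c - z) := by
    intro z hz
    rw [mem_ball_zero_iff] at hz
    have e := hermForm_add_add_hermForm_sub W (9 / 10) v z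
    have hz2 : |s * hermForm W z| ≤ |s| * ‖W‖ * (1 / 10) ^ 2 := by
      rw [abs_mul, mul_assoc]
      gcongr
      exact (abs_hermForm_le W z).trans (by gcongr)
    have hz3 := (abs_le.mp hz2).1
    have hsum : 2 * (4 / 5 * (|s| * ‖W‖)) ≤
        s * hermForm W (c + z) + s * hermForm W (c - z) := by
      rw [← mul_add, e]
      nlinarith
    simp only [hh]
    have h2 (r : ℝ) : 2 * ENNReal.ofReal r = ENNReal.ofReal (2 * r) := by
      rw [ENNReal.ofReal_mul (by norm_num), ENNReal.ofReal_ofNat]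
    rw [← ENNReal.ofReal_add (Real.exp_pos _).le (Real.exp_pos _).le, h2]
    apply ENNReal.ofReal_le_ofReal
    set p := s * hermForm W (c + z)
    set q := s * hermForm W (c - z)
    have hp : Real.exp ((p + q) / 2) ^ 2 = Real.exp p * Real.exp q := by
      rw [← Real.exp_add, ← Real.exp_nat_mul]; ring_nf
    have h1 : Real.exp (4 / 5 * (|s| * ‖W‖)) ≤ Real.exp ((p + q) / 2) :=
      Real.exp_le_exp.mpr (by linarith)
    -- The arithmetic-geometric mean inequality for the two exponentials.
    have h2 : 2 * Real.exp ((p + q) / 2) ≤ Real.exp p + Real.exp q := by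
      apply abs_le_of_sq_le_sq' _ (by positivity) |>.2
      nlinarith [sq_nonneg (Real.exp p - Real.exp q)]
    linarith
  have h2A : 2 * (ENNReal.ofReal (Real.exp (4 / 5 * (|s| * ‖W‖))) * ν (ball 0 (1 / 10))) ≤
      2 * A := by
    calc _ = ∫⁻ _ in ball 0 (1 / 10), 2 * ENNReal.ofReal (Real.exp (4 / 5 * (|s| * ‖W‖))) ∂ν := by
          rw [setLIntegral_const, mul_assoc]
      _ ≤ ∫⁻ z in ball 0 (1 / 10), (h (c + z) + h (c - z)) ∂ν :=
          setLIntegral_mono (by fun_prop) hpt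
      _ = A + A := by
          rw [lintegral_add_left (by fun_prop), ← hadd, ← hsub]
      _ = 2 * A := (two_mul A).symm
  exact ((ENNReal.mul_le_mul_iff_right (by norm_num) (by norm_num)).mp h2A).trans hAle

open Metric in
theorem measure_lt_norm_le_of_lintegral_exp_hermForm_le {Ω : Type*} [MeasurableSpace Ω]
    {μ : Measure Ω} [SFinite μ] (hM : 0 < M) {W : Ω → Matrix (Fin M) (Fin M) ℂ}
    (hW : ∀ ω, (W ω).IsHermitian) (hmeas : ∀ i j, Measurable fun ω => W ω i j) {C θ t : ℝ}
    (hθ : 0 ≤ θ)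
    (hC : ∀ s, |s| = θ → ∀ y : EuclideanSpace ℂ (Fin M), ‖y‖ ≤ 1 →
      ∫⁻ ω, ENNReal.ofReal (Real.exp (s * hermForm (W ω) y)) ∂μ ≤ ENNReal.ofReal C) :
    μ {ω | t < ‖W ω‖} ≤ ENNReal.ofReal (2 * C * 100 ^ M * Real.exp (-(4 / 5 * (θ * t)))) := by
  set ν : Measure (EuclideanSpace ℂ (Fin M)) := Measure.addHaar with hν
  set V := ν (ball 0 1) with hV
  have hV0 : V ≠ 0 := (measure_ball_pos ν 0 one_pos).ne'
  have hVt : V ≠ ∞ := measure_ball_lt_top.ne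
  -- The real dimension is `2 M`, so the volume ratio is `(1/10)^(2M)`.
  have hsmall : ν (ball 0 (1 / 10)) = ENNReal.ofReal ((100 ^ M)⁻¹) * V := by
    rw [Measure.addHaar_ball_of_pos ν _ (by norm_num), finrank_real_of_complex,
      finrank_euclideanSpace_fin, pow_mul, ← inv_pow]
    norm_num [hV]
  have hjm : ∀ s : ℝ, Measurable fun p : Ω × EuclideanSpace ℂ (Fin M) =>
      ENNReal.ofReal (Real.exp (s * hermForm (W p.1) p.2)) := by
    intro s
    have h1 : ∀ i j, Measurable fun p : Ω × EuclideanSpace ℂ (Fin M) => W p.1 i j :=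
      fun i j => (hmeas i j).comp measurable_fst
    simp only [hermForm, dotProduct, Matrix.mulVec]
    fun_prop
  set F : ℝ → Ω → ℝ≥0∞ := fun s ω =>
    ∫⁻ y in ball 0 1, ENNReal.ofReal (Real.exp (s * hermForm (W ω) y)) ∂ν with hF
  have hFm : ∀ s, Measurable (F s) := fun s => Measurable.lintegral_prod_right' (hjm s)
  have hFint : ∀ s, |s| = θ → ∫⁻ ω, F s ω ∂μ ≤ ENNReal.ofReal C * V := by
    intro s hs
    rw [hF, lintegral_lintegral_swap (hjm s).aemeasurable, ← setLIntegral_const]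
    refine setLIntegral_mono measurable_const fun y hy => hC s hs y ?_
    exact (mem_ball_zero_iff.mp hy).le
  -- The extremal eigenvalue may have either sign, so both `θ` and `-θ` are used; this costs the
  -- factor `2`.
  have hlow : ∀ ω, t < ‖W ω‖ →
      ENNReal.ofReal (Real.exp (4 / 5 * (θ * t)) * (100 ^ M)⁻¹) * V ≤ F θ ω + F (-θ) ω := by
    intro ω hω
    have hle : ENNReal.ofReal (Real.exp (4 / 5 * (θ * t)) * (100 ^ M)⁻¹) * V ≤
        ENNReal.ofReal (Real.exp (4 / 5 * (θ * ‖W ω‖))) * ν (ball 0 (1 / 10)) := by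
      rw [hsmall, ← mul_assoc (ENNReal.ofReal (Real.exp _)),
        ← ENNReal.ofReal_mul (Real.exp_pos _).le]
      gcongr
    refine hle.trans ?_
    obtain ⟨v, hv, hvW⟩ := exists_abs_hermForm_eq_norm hM (hW ω)
    rcases abs_choice (hermForm (W ω) v) with h | h
    · have := ofReal_exp_mul_measure_ball_le_lintegral ν (s := θ) hv
        (by rw [abs_of_nonneg hθ, ← hvW, h])
      rw [abs_of_nonneg hθ] at this
      exact this.trans le_self_add
    · have := ofReal_exp_mul_measure_ball_le_lintegral ν (s := -θ) hv
        (by rw [abs_neg, abs_of_nonneg hθ, ← hvW, h]; ring)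
      rw [abs_neg, abs_of_nonneg hθ] at this
      exact this.trans le_add_self
  have hmarkov : ENNReal.ofReal (Real.exp (4 / 5 * (θ * t)) * (100 ^ M)⁻¹) * V *
      μ {ω | t < ‖W ω‖} ≤ 2 * (ENNReal.ofReal C * V) := by
    calc _ ≤ ENNReal.ofReal (Real.exp (4 / 5 * (θ * t)) * (100 ^ M)⁻¹) * V *
          μ {ω | ENNReal.ofReal (Real.exp (4 / 5 * (θ * t)) * (100 ^ M)⁻¹) * V ≤
            F θ ω + F (-θ) ω} := by
          gcongr
          exact hlow _
      _ ≤ ∫⁻ ω, (F θ ω + F (-θ) ω) ∂μ :=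
          mul_meas_ge_le_lintegral ((hFm θ).add (hFm (-θ))) _
      _ = ∫⁻ ω, F θ ω ∂μ + ∫⁻ ω, F (-θ) ω ∂μ := lintegral_add_left (hFm θ) _
      _ ≤ _ := by
          rw [two_mul]
          exact add_le_add (hFint _ (abs_of_nonneg hθ))
            (hFint _ (by rw [abs_neg, abs_of_nonneg hθ]))
  have hpos : 0 < Real.exp (4 / 5 * (θ * t)) * ((100 : ℝ) ^ M)⁻¹ := by positivity
  have hm2 : ENNReal.ofReal (Real.exp (4 / 5 * (θ * t)) * (100 ^ M)⁻¹) * μ {ω | t < ‖W ω‖} ≤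
      ENNReal.ofReal (2 * C) := by
    rw [← ENNReal.mul_le_mul_iff_left hV0 hVt, ENNReal.ofReal_mul (p := 2) (by norm_num)]
    simp only [ENNReal.ofReal_ofNat]
    calc _ = _ := by ring
      _ ≤ _ := hmarkov
      _ = _ := by ring
  rw [mul_comm, ← ENNReal.le_div_iff_mul_le (Or.inl (by simpa using hpos))
    (Or.inl ENNReal.ofReal_ne_top), ← ENNReal.ofReal_div_of_pos hpos] at hm2
  refine hm2.trans (ENNReal.ofReal_le_ofReal (le_of_eq ?_))
  rw [Real.exp_neg]
  field_simp

end HermitianForm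

/-! ### Tail bounds for the noise covariance and the cross term of one subarray. -/

section GaussianMatrix

/-- The series starts at order two, so each term is at most `m²` times the term at `9/10`. This
controls the centred exponential moment of `‖z‖²`. -/
theorem neg_log_one_sub_sub_le {u m : ℝ} (hm : m ≤ 1) (hu : |u| ≤ 9 / 10 * m) :
    -Real.log (1 - u) - u ≤ m ^ 2 * (Real.log 10 - 9 / 10) := by
  have hm0 : 0 ≤ m := by have := abs_nonneg u; linarith
  have hs : ∀ x : ℝ, |x| < 1 → HasSum (fun n : ℕ => x ^ (n + 2) / ((n : ℝ) + 2))
      (-Real.log (1 - x) - x) := by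
    intro x hx
    have := (hasSum_nat_add_iff' 1).mpr (Real.hasSum_pow_div_log_of_abs_lt_one hx)
    simp only [Finset.range_one, Finset.sum_singleton, zero_add, pow_one, Nat.cast_zero,
      div_one] at this
    have e : (fun n : ℕ => x ^ (n + 2) / ((n : ℝ) + 2)) =
        fun n : ℕ => x ^ (n + 1 + 1) / (((n + 1 : ℕ) : ℝ) + 1) := by
      funext n
      push_cast
      ring_nf
    rw [e]
    exact this
  have h1 := hs u (by linarith)
  have h2 := (hs (9 / 10) (by rw [abs_of_pos] <;> norm_num)).mul_left (m ^ 2)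
  have e : -Real.log (1 - 9 / 10) - 9 / 10 = Real.log 10 - 9 / 10 := by
    rw [← Real.log_inv]; norm_num
  rw [e] at h2
  refine hasSum_le (fun n => ?_) h1 h2
  rw [← mul_div_assoc]
  gcongr
  calc u ^ (n + 2) ≤ |u ^ (n + 2)| := le_abs_self _
    _ = |u| ^ (n + 2) := abs_pow _ _
    _ ≤ (9 / 10 * m) ^ (n + 2) := by gcongr
    _ = m ^ n * m ^ 2 * (9 / 10) ^ (n + 2) := by ring
    _ ≤ 1 * m ^ 2 * (9 / 10) ^ (n + 2) := by gcongr; exact pow_le_one₀ hm0 hm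
    _ = _ := by ring

theorem three_mul_log_ten_le : 3 * Real.log 10 ≤ 7 := by
  have h : Real.log (10 ^ 3) ≤ 7 := by
    rw [Real.log_le_iff_le_exp (by norm_num), show (7 : ℝ) = (7 : ℕ) * 1 by norm_num,
      Real.exp_nat_mul]
    calc (10 : ℝ) ^ 3 ≤ 2.7182818283 ^ 7 := by norm_num
      _ ≤ _ := by gcongr; exact Real.exp_one_gt_d9.le
  rw [Real.log_pow] at h
  exact_mod_cast h

variable {Ω : Type*} [MeasurableSpace Ω] {μ : Measure Ω} {M L : ℕ}
  {X : Ω → Matrix (Fin M) (Fin L) ℂ} {v : ℝ}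

theorem ae_eq_zero_of_hasLaw_complexGaussian_zero
    (hlaw : ∀ i j, HasLaw (fun ω => X ω i j) (complexGaussian 0) μ) : ∀ᵐ ω ∂μ, X ω = 0 := by
  have h : ∀ i j, ∀ᵐ ω ∂μ, X ω i j = 0 := fun i j => by
    have := hlaw i j
    rw [complexGaussian_zero] at this
    exact this.ae_eq_of_dirac
  filter_upwards [ae_all_iff.mpr fun i => ae_all_iff.mpr fun j => h i j] with ω hω
  ext i j
  exact hω i j

variable [IsProbabilityMeasure μ]

/-- The entries of `Xᴴ y` come from different columns of `X`, hence are independent, and each is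
complex Gaussian of variance `v ‖y‖²`. -/
theorem lintegral_prod_conjTranspose_mulVec (hv : 0 ≤ v) (hm : ∀ i j, Measurable fun ω => X ω i j)
    (hX : iIndepFun (fun (p : Fin M × Fin L) ω => X ω p.1 p.2) μ)
    (hlaw : ∀ i j, HasLaw (fun ω => X ω i j) (complexGaussian v) μ)
    (y : EuclideanSpace ℂ (Fin M)) {φ : Fin L → ℂ → ℝ≥0∞} (hφ : ∀ l, Measurable (φ l)) :
    ∫⁻ ω, ∏ l, φ l (((X ω)ᴴ *ᵥ y.ofLp) l) ∂μ =
      ∏ l, ∫⁻ z, φ l z ∂complexGaussian (v * ‖y‖ ^ 2) := by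
  have hg : ∀ ω l, ((X ω)ᴴ *ᵥ y.ofLp) l = ∑ i, conj (X ω i l) * y.ofLp i := fun ω l => rfl
  have hcol := iIndepFun.columns (X := fun i l ω => X ω i l) hX hlaw
  have hind : iIndepFun (fun l ω => φ l (((X ω)ᴴ *ᵥ y.ofLp) l)) μ := by
    refine hcol.comp (fun l x => φ l (∑ i, conj (x i) * y.ofLp i)) fun l => ?_
    have := hφ l
    fun_prop
  rw [lintegral_prod_eq_prod_lintegral_of_indepFun _ _ hind]
  · refine Finset.prod_congr rfl fun l _ => ?_
    have hc : iIndepFun (fun i ω => X ω i l) μ :=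
      hX.precomp (g := fun i => (i, l)) (fun a b h => (Prod.mk.inj h).1)
    have h := hasLaw_sum_conj_mul hv hc (fun i => hlaw i l) y.ofLp
    rw [← EuclideanSpace.norm_sq_eq] at h
    exact h.lintegral_comp (hφ l).aemeasurable
  · intro l
    simp only [hg]
    have := hφ l
    fun_prop

theorem star_dotProduct_mul_conjTranspose_mulVec (A B : Matrix (Fin M) (Fin L) ℂ) (y : Fin M → ℂ) :
    star y ⬝ᵥ (A * Bᴴ) *ᵥ y = ∑ l, conj ((Aᴴ *ᵥ y) l) * (Bᴴ *ᵥ y) l := by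
  rw [← Matrix.mulVec_mulVec, Matrix.dotProduct_mulVec]
  have : star y ᵥ* A = star (Aᴴ *ᵥ y) := by rw [Matrix.star_mulVec, Matrix.conjTranspose_conjTranspose]
  rw [this]
  rfl

theorem hermForm_mul_conjTranspose_sub (A : Matrix (Fin M) (Fin L) ℂ) (c : ℝ)
    (y : EuclideanSpace ℂ (Fin M)) :
    hermForm (A * Aᴴ - (c : ℂ) • 1) y = ∑ l, ‖(Aᴴ *ᵥ y.ofLp) l‖ ^ 2 - c * ‖y‖ ^ 2 := by
  rw [hermForm, Matrix.sub_mulVec, dotProduct_sub, star_dotProduct_mul_conjTranspose_mulVec,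
    Matrix.smul_mulVec, Matrix.one_mulVec, dotProduct_smul]
  have h1 : star y.ofLp ⬝ᵥ y.ofLp = ((‖y‖ ^ 2 : ℝ) : ℂ) := by
    rw [dotProduct_comm, ← EuclideanSpace.inner_eq_star_dotProduct, inner_self_eq_norm_sq_to_K]
    simp
  rw [h1, smul_eq_mul, ← Complex.ofReal_mul, Complex.sub_re, Complex.re_sum, Complex.ofReal_re]
  congr 1
  refine Finset.sum_congr rfl fun l _ => ?_
  rw [mul_comm, Complex.mul_conj, Complex.ofReal_re, Complex.normSq_eq_norm_sq]

theorem hermForm_mul_conjTranspose_add (A B : Matrix (Fin M) (Fin L) ℂ)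
    (y : EuclideanSpace ℂ (Fin M)) :
    hermForm (B * Aᴴ + A * Bᴴ) y =
      ∑ l, 2 * (conj ((Bᴴ *ᵥ y.ofLp) l) * (Aᴴ *ᵥ y.ofLp) l).re := by
  rw [hermForm, Matrix.add_mulVec, dotProduct_add, star_dotProduct_mul_conjTranspose_mulVec,
    star_dotProduct_mul_conjTranspose_mulVec, ← Finset.sum_add_distrib, Complex.re_sum]
  refine Finset.sum_congr rfl fun l _ => ?_
  simp only [Complex.add_re, Complex.mul_re, Complex.conj_re, Complex.conj_im]
  ring


/-- Deviation of the sample covariance of a complex Gaussian matrix from its mean. -/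
theorem measure_lt_norm_mul_conjTranspose_sub_le (hM : 0 < M) (hL : 0 < L) (hv : 0 ≤ v)
    (hm : ∀ i j, Measurable fun ω => X ω i j)
    (hX : iIndepFun (fun (p : Fin M × Fin L) ω => X ω p.1 p.2) μ)
    (hlaw : ∀ i j, HasLaw (fun ω => X ω i j) (complexGaussian v) μ) :
    μ {ω | 10 * v * L * max (√((M : ℝ) / L)) ((M : ℝ) / L) <
        ‖X ω * (X ω)ᴴ - ((v * L : ℝ) : ℂ) • (1 : Matrix (Fin M) (Fin M) ℂ)‖} ≤
      ENNReal.ofReal (2 * Real.exp (-(M : ℝ) / 2)) := by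
  rcases hv.eq_or_lt with rfl | hv
  · refine (le_of_eq ?_).trans zero_le
    rw [measure_eq_zero_iff_ae_notMem]
    filter_upwards [ae_eq_zero_of_hasLaw_complexGaussian_zero hlaw] with ω hω
    simp [hω]
  have hM' : (0 : ℝ) < M := by exact_mod_cast hM
  have hL' : (0 : ℝ) < L := by exact_mod_cast hL
  set r : ℝ := (M : ℝ) / L with hr
  have hr0 : 0 < r := by positivity
  -- `m` keeps the tilt below the blow-up of the moment at `u = 1`. Two facts matter: `m * max (√r)
  -- r = r`, so both regimes give the same exponent, and `m² ≤ r`.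
  set m : ℝ := min (√r) 1 with hmdef
  have hm0 : 0 < m := lt_min (Real.sqrt_pos.mpr hr0) one_pos
  have hsq : √r * √r = r := Real.mul_self_sqrt hr0.le
  have hmm : m * max (√r) r = r := by
    rcases le_total (√r) 1 with h | h
    · rw [hmdef, min_eq_left h, max_eq_left (by nlinarith [Real.sqrt_nonneg r]), hsq]
    · rw [hmdef, min_eq_right h, max_eq_right (by nlinarith), one_mul]
  have hm2 : m ^ 2 ≤ r := by
    rw [← Real.sq_sqrt hr0.le]
    gcongr
    exact min_le_left _ _
  have hlog : 9 / 10 ≤ Real.log 10 := by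
    rw [Real.le_log_iff_exp_le (by norm_num)]
    exact (Real.exp_le_exp.mpr (by norm_num : (9 / 10 : ℝ) ≤ 1)).trans
      (Real.exp_one_lt_d9.le.trans (by norm_num))
  have hθ : 0 ≤ 9 / 10 * m / v := by positivity
  refine (measure_lt_norm_le_of_lintegral_exp_hermForm_le hM (fun ω => ?_) (fun i j => ?_)
    (C := Real.exp (M * (Real.log 10 - 9 / 10))) hθ fun s hs y hy => ?_).trans
    (ENNReal.ofReal_le_ofReal ?_)
  · refine (Matrix.isHermitian_mul_conjTranspose_self _).sub ?_
    rw [Matrix.IsHermitian, Matrix.conjTranspose_smul, Matrix.conjTranspose_one]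
    simp
  · simp only [Matrix.sub_apply, Matrix.mul_apply, Matrix.conjTranspose_apply]
    have h : ∀ i j, Measurable fun ω => star (X ω i j) := fun i j =>
      Complex.continuous_conj.measurable.comp (hm i j)
    fun_prop
  · set u := s * (v * ‖y‖ ^ 2) with hu
    have hum : |u| ≤ 9 / 10 * m := by
      rw [hu, abs_mul, hs, abs_of_nonneg (by positivity)]
      calc 9 / 10 * m / v * (v * ‖y‖ ^ 2) = 9 / 10 * m * ‖y‖ ^ 2 := by field_simp
        _ ≤ 9 / 10 * m * 1 := by gcongr; exact pow_le_one₀ (norm_nonneg y) hy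
        _ = _ := mul_one _
    have hu1 : u < 1 := by
      have := le_abs_self u
      have := min_le_right (√r) 1
      linarith
    have e : ∀ ω, ENNReal.ofReal (Real.exp (s *
        hermForm (X ω * (X ω)ᴴ - ((v * L : ℝ) : ℂ) • (1 : Matrix (Fin M) (Fin M) ℂ)) y)) =
        ENNReal.ofReal (Real.exp (-(u * L))) *
          ∏ l, ENNReal.ofReal (Real.exp (s * ‖((X ω)ᴴ *ᵥ y.ofLp) l‖ ^ 2)) := by
      intro ω
      rw [← ENNReal.ofReal_prod_of_nonneg (fun l _ => (Real.exp_pos _).le), ← Real.exp_sum,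
        ← ENNReal.ofReal_mul (Real.exp_pos _).le, ← Real.exp_add, hermForm_mul_conjTranspose_sub,
        ← Finset.mul_sum]
      congr 2
      rw [hu]
      ring
    rw [lintegral_congr e, lintegral_const_mul', lintegral_prod_conjTranspose_mulVec hv.le hm hX hlaw y
      (φ := fun _ z => ENNReal.ofReal (Real.exp (s * ‖z‖ ^ 2))) (fun _ => by fun_prop),
      lintegral_exp_mul_normSq_complexGaussian (by positivity) hu1, Finset.prod_const,
      Finset.card_univ, Fintype.card_fin, ← ENNReal.ofReal_pow (by
        rw [inv_nonneg]; linarith), ← ENNReal.ofReal_mul (Real.exp_pos _).le]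
    · apply ENNReal.ofReal_le_ofReal
      have h1 : (1 - u)⁻¹ = Real.exp (-Real.log (1 - u)) := by
        rw [Real.exp_neg, Real.exp_log (by linarith)]
      rw [← hu, h1, ← Real.exp_nat_mul, ← Real.exp_add, Real.exp_le_exp]
      calc -(u * L) + L * -Real.log (1 - u) = L * (-Real.log (1 - u) - u) := by ring
        _ ≤ L * (m ^ 2 * (Real.log 10 - 9 / 10)) := by
            gcongr
            exact neg_log_one_sub_sub_le (min_le_right _ _) hum
        _ ≤ L * (r * (Real.log 10 - 9 / 10)) := by
            have : 0 ≤ Real.log 10 - 9 / 10 := by linarith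
            gcongr
        _ = M * (Real.log 10 - 9 / 10) := by rw [hr]; field_simp
    · exact ENNReal.ofReal_ne_top
  · have h1 : 9 / 10 * m / v * (10 * v * L * max (√r) r) = 9 * M := by
      calc _ = 9 * L * (m * max (√r) r) := by field_simp
        _ = 9 * M := by rw [hmm, hr]; field_simp
    have h2 : (100 : ℝ) ^ M = Real.exp (M * (2 * Real.log 10)) := by
      rw [Real.exp_nat_mul, Real.exp_mul, ← Real.exp_mul, mul_comm, Real.exp_mul,
        Real.exp_log (by norm_num)]
      norm_num
    -- The total exponent is `M (3 log 10 - 0.9 - 7.2)`, at most `-1.1 M`.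
    rw [h1, h2, mul_assoc 2, ← Real.exp_add, mul_assoc 2, ← Real.exp_add]
    gcongr
    nlinarith [three_mul_log_ten_le]

/-- Deviation of the Hermitian cross term between a fixed matrix and a complex Gaussian matrix. -/
theorem measure_lt_norm_mul_conjTranspose_add_le (hM : 0 < M) (hv : 0 ≤ v)
    (hm : ∀ i j, Measurable fun ω => X ω i j)
    (hX : iIndepFun (fun (p : Fin M × Fin L) ω => X ω p.1 p.2) μ)
    (hlaw : ∀ i j, HasLaw (fun ω => X ω i j) (complexGaussian v) μ)
    (B : Matrix (Fin M) (Fin L) ℂ) :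
    μ {ω | 15 / 2 * (‖B‖ * √v * √M) < ‖B * (X ω)ᴴ + X ω * Bᴴ‖} ≤
      ENNReal.ofReal (Real.exp (-(M : ℝ) / 2)) := by
  rcases hv.eq_or_lt with rfl | hv
  · refine (le_of_eq ?_).trans zero_le
    rw [measure_eq_zero_iff_ae_notMem]
    filter_upwards [ae_eq_zero_of_hasLaw_complexGaussian_zero hlaw] with ω hω
    simp [hω]
  rcases eq_or_ne B 0 with rfl | hB
  · simp
  have hB' : 0 < ‖B‖ := norm_pos_iff.mpr hB
  have hM' : (1 : ℝ) ≤ M := by exact_mod_cast hM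
  have hsv : 0 < √v := Real.sqrt_pos.mpr hv
  have hsv2 : √v ^ 2 = v := Real.sq_sqrt hv.le
  have hsM2 : √(M : ℝ) ^ 2 = M := Real.sq_sqrt (by positivity)
  -- This tilt makes the moment at most `exp(9 M)`, while the threshold contributes `exp(-18 M)`.
  have hθ : 0 ≤ 3 * √M / (‖B‖ * √v) := by positivity
  refine (measure_lt_norm_le_of_lintegral_exp_hermForm_le hM (fun ω => ?_) (fun i j => ?_)
    (C := Real.exp (9 * M)) hθ fun s hs y hy => ?_).trans
    (ENNReal.ofReal_le_ofReal ?_)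
  · rw [Matrix.IsHermitian, Matrix.conjTranspose_add, Matrix.conjTranspose_mul,
      Matrix.conjTranspose_mul, Matrix.conjTranspose_conjTranspose,
      Matrix.conjTranspose_conjTranspose, add_comm]
  · simp only [Matrix.add_apply, Matrix.mul_apply, Matrix.conjTranspose_apply]
    have h : ∀ i j, Measurable fun ω => star (X ω i j) := fun i j =>
      Complex.continuous_conj.measurable.comp (hm i j)
    fun_prop
  · set b := Bᴴ *ᵥ y.ofLp with hb
    have e : ∀ ω, ENNReal.ofReal (Real.exp (s * hermForm (B * (X ω)ᴴ + X ω * Bᴴ) y)) =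
          ∏ l, ENNReal.ofReal (Real.exp (2 * (conj ((s : ℂ) * b l) * ((X ω)ᴴ *ᵥ y.ofLp) l).re)) := by
      intro ω
      rw [← ENNReal.ofReal_prod_of_nonneg (fun l _ => (Real.exp_pos _).le), ← Real.exp_sum,
        hermForm_mul_conjTranspose_add, Finset.mul_sum]
      congr 2
      refine Finset.sum_congr rfl fun l _ => ?_
      rw [map_mul, Complex.conj_ofReal, mul_assoc, Complex.re_ofReal_mul]
      ring
    have hbn : ∑ l, ‖b l‖ ^ 2 ≤ ‖B‖ ^ 2 := by
      have h1 := Matrix.l2_opNorm_mulVec Bᴴ y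
      rw [Matrix.l2_opNorm_conjTranspose] at h1
      have h2 : ∑ l, ‖b l‖ ^ 2 = ‖WithLp.toLp 2 (Bᴴ *ᵥ y.ofLp)‖ ^ 2 :=
        (EuclideanSpace.norm_sq_eq (WithLp.toLp 2 (Bᴴ *ᵥ y.ofLp))).symm
      rw [h2]
      gcongr
      exact h1.trans (mul_le_of_le_one_right hB'.le hy)
    rw [lintegral_congr e, lintegral_prod_conjTranspose_mulVec hv.le hm hX hlaw y
      (φ := fun l z => ENNReal.ofReal (Real.exp (2 * (conj ((s : ℂ) * b l) * z).re)))
      (fun _ => by fun_prop),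
      Finset.prod_congr rfl fun l _ => lintegral_exp_re_complexGaussian (by positivity) _,
      ← ENNReal.ofReal_prod_of_nonneg (fun l _ => (Real.exp_pos _).le), ← Real.exp_sum]
    apply ENNReal.ofReal_le_ofReal
    rw [Real.exp_le_exp]
    have hs2 : s ^ 2 = 9 * M / (‖B‖ ^ 2 * v) := by
      rw [← sq_abs, hs, div_pow, mul_pow, mul_pow, hsv2, hsM2]
      norm_num
    calc ∑ l, ‖(s : ℂ) * b l‖ ^ 2 * (v * ‖y‖ ^ 2)
        = s ^ 2 * (∑ l, ‖b l‖ ^ 2) * (v * ‖y‖ ^ 2) := by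
          rw [← Finset.sum_mul, Finset.mul_sum]
          congr 1
          refine Finset.sum_congr rfl fun l _ => ?_
          rw [norm_mul, Complex.norm_real, mul_pow, Real.norm_eq_abs, sq_abs]
      _ ≤ s ^ 2 * ‖B‖ ^ 2 * (v * 1) := by
          gcongr
          exact pow_le_one₀ (norm_nonneg y) hy
      _ = 9 * M := by rw [hs2]; field_simp
  · have h1 : 3 * √M / (‖B‖ * √v) * (15 / 2 * (‖B‖ * √v * √M)) = 45 / 2 * M := by
      field_simp
      ring_nf
      rw [hsM2]
    have h2 : (100 : ℝ) ^ M = Real.exp (M * (2 * Real.log 10)) := by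
      rw [Real.exp_nat_mul, Real.exp_mul, ← Real.exp_mul, mul_comm, Real.exp_mul,
        Real.exp_log (by norm_num)]
      norm_num
    -- The prefactor `2` is absorbed into the exponent, which has room since `M ≥ 1`; the cross term
    -- thus costs only one `exp(-M/2)`.
    have h3 : (2 : ℝ) ≤ Real.exp 1 := by linarith [Real.exp_one_gt_d9]
    rw [h1, h2, mul_assoc 2, ← Real.exp_add, mul_assoc 2, ← Real.exp_add]
    refine (mul_le_mul_of_nonneg_right h3 (Real.exp_pos _).le).trans ?_
    rw [← Real.exp_add, Real.exp_le_exp]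
    nlinarith [three_mul_log_ten_le]

end GaussianMatrix

/-! ### Singular values through the eigenbasis of `T* T`. -/

section SingularValues

open Module

variable {𝕜 E F : Type*} [RCLike 𝕜] [NormedAddCommGroup E] [InnerProductSpace 𝕜 E]
  [FiniteDimensional 𝕜 E] [NormedAddCommGroup F] [InnerProductSpace 𝕜 F] [FiniteDimensional 𝕜 F]

theorem LinearMap.norm_sq_apply_eq_sum_eigenvalues (T : E →ₗ[𝕜] F) {n : ℕ}
    (hn : finrank 𝕜 E = n) (x : E) :
    ‖T x‖ ^ 2 = ∑ i, T.isSymmetric_adjoint_comp_self.eigenvalues hn i *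
      ‖inner 𝕜 (T.isSymmetric_adjoint_comp_self.eigenvectorBasis hn i) x‖ ^ 2 := by
  set hG := T.isSymmetric_adjoint_comp_self
  set b := hG.eigenvectorBasis hn
  have h1 : inner 𝕜 x ((LinearMap.adjoint T ∘ₗ T) x) = ((‖T x‖ ^ 2 : ℝ) : 𝕜) := by
    rw [LinearMap.comp_apply, LinearMap.adjoint_inner_right, inner_self_eq_norm_sq_to_K]
    push_cast
    rfl
  have h2 : inner 𝕜 x ((LinearMap.adjoint T ∘ₗ T) x) =
      ((∑ i, hG.eigenvalues hn i * ‖inner 𝕜 (b i) x‖ ^ 2 : ℝ) : 𝕜) := by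
    rw [← b.sum_inner_mul_inner, RCLike.ofReal_sum]
    refine Finset.sum_congr rfl fun i _ => ?_
    have : inner 𝕜 (b i) ((LinearMap.adjoint T ∘ₗ T) x) =
        (hG.eigenvalues hn i : 𝕜) * inner 𝕜 (b i) x := by
      rw [← hG, hG.apply_eigenvectorBasis hn i, inner_smul_left, RCLike.conj_ofReal]
    rw [this, mul_left_comm, ← inner_conj_symm x (b i), RCLike.conj_mul]
    push_cast
    rfl
  exact RCLike.ofReal_injective (h1.symm.trans h2)

/-- In the eigenbasis this is `σ_min² λ_i ≤ λ_i²`. It bounds the adjoint from below on the range of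
`T`, where the signal eigenvectors live. -/
theorem LinearMap.sq_singularValues_mul_norm_sq_le (T : E →ₗ[𝕜] F) {n : ℕ} (hn : finrank 𝕜 E = n)
    (x : E) : T.singularValues (n - 1) ^ 2 * ‖T x‖ ^ 2 ≤ ‖LinearMap.adjoint T (T x)‖ ^ 2 := by
  set hG := T.isSymmetric_adjoint_comp_self
  set b := hG.eigenvectorBasis hn
  rw [T.norm_sq_apply_eq_sum_eigenvalues hn, ← b.sum_sq_norm_inner_right, Finset.mul_sum]
  refine Finset.sum_le_sum fun i _ => ?_
  have h1 : inner 𝕜 (b i) (LinearMap.adjoint T (T x)) =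
      (hG.eigenvalues hn i : 𝕜) * inner 𝕜 (b i) x := by
    rw [← LinearMap.comp_apply, ← hG, hG.apply_eigenvectorBasis hn i, inner_smul_left,
      RCLike.conj_ofReal]
  have h0 : 0 ≤ hG.eigenvalues hn i := T.isPositive_adjoint_comp_self.nonneg_eigenvalues hn i
  have h2 : T.singularValues (n - 1) ^ 2 ≤ hG.eigenvalues hn i := by
    rw [← T.sq_singularValues_fin hn i]
    have := T.singularValues_nonneg (n - 1)
    gcongr
    exact T.singularValues_antitone (by omega)
  rw [h1, norm_mul, mul_pow, RCLike.norm_ofReal, sq_abs, ← mul_assoc, pow_two (hG.eigenvalues hn i)]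
  gcongr

theorem LinearMap.le_sq_singularValues (T : E →ₗ[𝕜] F) {c : ℝ}
    (hc : ∀ x, c * ‖x‖ ^ 2 ≤ ‖T x‖ ^ 2) {j : ℕ} (hj : j < finrank 𝕜 E) :
    c ≤ T.singularValues j ^ 2 := by
  rw [T.sq_singularValues_of_lt rfl hj]
  set hG := T.isSymmetric_adjoint_comp_self
  set b := hG.eigenvectorBasis rfl
  have h := hc (b ⟨j, hj⟩)
  rw [b.orthonormal.1, T.norm_sq_apply_eq_sum_eigenvalues rfl] at h
  rw [Finset.sum_eq_single ⟨j, hj⟩] at h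
  · rw [inner_self_eq_norm_sq_to_K, b.orthonormal.1] at h
    simpa using h
  · intro i _ hi
    rw [b.orthonormal.2 hi]
    simp
  · simp

end SingularValues

/-! ### Eigenvalue bounds from quadratic forms on subspaces. -/

section CourantFischer

open Module

variable {M : ℕ}

theorem hermForm_mul_diagonal_mul (V : Matrix (Fin M) (Fin M) ℂ) (ev : Fin M → ℝ)
    (x : EuclideanSpace ℂ (Fin M)) :
    hermForm (V * Matrix.diagonal (fun j => (ev j : ℂ)) * Vᴴ) x =
      ∑ i, ev i * ‖(Vᴴ *ᵥ x.ofLp) i‖ ^ 2 := by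
  rw [hermForm, ← Matrix.mulVec_mulVec, ← Matrix.mulVec_mulVec, Matrix.dotProduct_mulVec]
  have : star x.ofLp ᵥ* V = star (Vᴴ *ᵥ x.ofLp) := by
    rw [Matrix.star_mulVec, Matrix.conjTranspose_conjTranspose]
  rw [this, dotProduct, Complex.re_sum]
  refine Finset.sum_congr rfl fun i _ => ?_
  rw [Matrix.mulVec_diagonal, mul_left_comm, Complex.re_ofReal_mul, ← Complex.normSq_eq_norm_sq,
    Pi.star_apply, mul_comm (star _), RCLike.star_def, Complex.mul_conj, Complex.ofReal_re]

theorem sum_norm_sq_unitary_mulVec {V : Matrix (Fin M) (Fin M) ℂ}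
    (hV : V ∈ Matrix.unitaryGroup (Fin M) ℂ) (x : EuclideanSpace ℂ (Fin M)) :
    ∑ i, ‖(Vᴴ *ᵥ x.ofLp) i‖ ^ 2 = ‖x‖ ^ 2 := by
  have h := hermForm_mul_diagonal_mul V (fun _ => 1) x
  have h1 : V * Matrix.diagonal (fun _ => ((1 : ℝ) : ℂ)) * Vᴴ = 1 := by
    simp only [Complex.ofReal_one, Matrix.diagonal_one, mul_one]
    exact Matrix.mem_unitaryGroup_iff.mp hV
  rw [h1, hermForm_eq_inner, Matrix.one_mulVec] at h
  simp only [one_mul] at h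
  rw [← h]
  simp [inner_self_eq_norm_sq_to_K, ← Complex.ofReal_pow]

theorem exists_mem_ne_zero_of_card_lt_finrank {E ι : Type*} [AddCommGroup E] [Module ℂ E]
    [Fintype ι] (W : Submodule ℂ E) [FiniteDimensional ℂ W] (g : E →ₗ[ℂ] (ι → ℂ))
    (h : Fintype.card ι < finrank ℂ W) : ∃ x ∈ W, x ≠ 0 ∧ g x = 0 := by
  have hker : LinearMap.ker (g ∘ₗ W.subtype) ≠ ⊥ :=
    LinearMap.ker_ne_bot_of_finrank_lt (by rwa [finrank_fintype_fun_eq_card])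
  obtain ⟨x, hx, hx0⟩ := (Submodule.ne_bot_iff _).mp hker
  exact ⟨x, x.2, by simpa using hx0, hx⟩

variable {V : Matrix (Fin M) (Fin M) ℂ} {ev : Fin M → ℝ}

theorem exists_mem_mulVec_eq_zero (V : Matrix (Fin M) (Fin M) ℂ)
    (W : Submodule ℂ (EuclideanSpace ℂ (Fin M))) (s : Finset (Fin M)) (h : s.card < finrank ℂ W) :
    ∃ x ∈ W, x ≠ 0 ∧ ∀ i ∈ s, (Vᴴ *ᵥ x.ofLp) i = 0 := by
  obtain ⟨x, hxW, hx0, hx⟩ := exists_mem_ne_zero_of_card_lt_finrank W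
    ((LinearMap.funLeft ℂ ℂ (fun i : s => (i : Fin M))) ∘ₗ Vᴴ.mulVecLin ∘ₗ
      (WithLp.linearEquiv 2 ℂ (Fin M → ℂ)).toLinearMap) (by simpa using h)
  exact ⟨x, hxW, hx0, fun i hi => congrFun hx ⟨i, hi⟩⟩

/-- The easy half of Courant-Fischer: since `dim W > j`, some nonzero vector of `W` is orthogonal to
the eigenvectors before index `j`, and there the form is at most `ev j ‖x‖²`. -/
theorem le_eigenvalue_of_le_hermForm (hV : V ∈ Matrix.unitaryGroup (Fin M) ℂ) (hev : Antitone ev)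
    (W : Submodule ℂ (EuclideanSpace ℂ (Fin M))) {c : ℝ}
    (hc : ∀ x ∈ W, c * ‖x‖ ^ 2 ≤
      hermForm (V * Matrix.diagonal (fun j => (ev j : ℂ)) * Vᴴ) x)
    (j : Fin M) (hj : j < finrank ℂ W) : c ≤ ev j := by
  obtain ⟨x, hxW, hx0, hx⟩ := exists_mem_mulVec_eq_zero V W (Finset.Iio j) (by simpa using hj)
  have h := hc x hxW
  have hle : hermForm (V * Matrix.diagonal (fun j => (ev j : ℂ)) * Vᴴ) x ≤ ev j * ‖x‖ ^ 2 := by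
    rw [hermForm_mul_diagonal_mul, ← sum_norm_sq_unitary_mulVec hV, Finset.mul_sum]
    refine Finset.sum_le_sum fun i _ => ?_
    rcases lt_or_ge i j with hij | hij
    · simp [hx i (Finset.mem_Iio.mpr hij)]
    · gcongr
      exact hev hij
  have hpos : 0 < ‖x‖ ^ 2 := by positivity
  exact le_of_mul_le_mul_right (h.trans hle) hpos

theorem eigenvalue_le_of_hermForm_le (hV : V ∈ Matrix.unitaryGroup (Fin M) ℂ) (hev : Antitone ev)
    (W : Submodule ℂ (EuclideanSpace ℂ (Fin M))) {c : ℝ}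
    (hc : ∀ x ∈ W, hermForm (V * Matrix.diagonal (fun j => (ev j : ℂ)) * Vᴴ) x ≤ c * ‖x‖ ^ 2)
    (j : Fin M) (hj : M ≤ j + finrank ℂ W) : ev j ≤ c := by
  obtain ⟨x, hxW, hx0, hx⟩ := exists_mem_mulVec_eq_zero V W (Finset.Ioi j)
    (by rw [Fin.card_Ioi]; omega)
  have h := hc x hxW
  have hle : ev j * ‖x‖ ^ 2 ≤ hermForm (V * Matrix.diagonal (fun j => (ev j : ℂ)) * Vᴴ) x := by
    rw [hermForm_mul_diagonal_mul, ← sum_norm_sq_unitary_mulVec hV, Finset.mul_sum]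
    refine Finset.sum_le_sum fun i _ => ?_
    rcases lt_or_ge j i with hij | hij
    · simp [hx i (Finset.mem_Ioi.mpr hij)]
    · gcongr
      exact hev hij
  have hpos : 0 < ‖x‖ ^ 2 := by positivity
  exact le_of_mul_le_mul_right (hle.trans h) hpos

theorem sortedEigenvalue_last_mul_norm_sq_le {H : Matrix (Fin M) (Fin M) ℂ} (hH : H.IsHermitian)
    (hM : 0 < M) (x : EuclideanSpace ℂ (Fin M)) :
    sortedEigenvalue hH ⟨M - 1, Nat.sub_lt hM one_pos⟩ * ‖x‖ ^ 2 ≤ hermForm H x := by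
  have h : H = (hH.eigenvectorUnitary : Matrix (Fin M) (Fin M) ℂ) *
      Matrix.diagonal (fun j => (hH.eigenvalues j : ℂ)) *
        (hH.eigenvectorUnitary : Matrix (Fin M) (Fin M) ℂ)ᴴ := by
    conv_lhs => rw [hH.spectral_theorem, Unitary.conjStarAlgAut_apply]
    rfl
  conv_rhs => rw [h]
  rw [hermForm_mul_diagonal_mul, ← sum_norm_sq_unitary_mulVec hH.eigenvectorUnitary.2,
    Finset.mul_sum]
  refine Finset.sum_le_sum fun i _ => ?_
  gcongr
  refine hH.eigenvalues₀_antitone ?_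
  rw [Fin.le_def]
  -- `eigenvalues` reindexes the sorted `eigenvalues₀` by an unspecified bijection; only the fact
  -- that every index is at most `M - 1` is needed.
  have := ((Fintype.equivOfCardEq (Fintype.card_fin (Fintype.card (Fin M)))).symm i).2
  simp only [Fin.val_cast]
  have := this.trans_eq (Fintype.card_fin M)
  omega

theorem sortedEigenvalue_pos {H : Matrix (Fin M) (Fin M) ℂ} (hH : H.PosDef) (j : Fin M) :
    0 < sortedEigenvalue hH.isHermitian j := by
  have h := hH.eigenvalues_pos
    (Fintype.equivOfCardEq (Fintype.card_fin (Fintype.card (Fin M)))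
      (Fin.cast (Fintype.card_fin M).symm j))
  simpa [Matrix.IsHermitian.eigenvalues, sortedEigenvalue] using h

end CourantFischer

/-! ### Canonical angles and the Davis-Kahan bound. -/

section DavisKahan

open Module

variable {M K : ℕ}

theorem sum_castLE_add_sum_ite (hKM : K ≤ M) (g : Fin M → ℝ) :
    ∑ k : Fin K, g (Fin.castLE hKM k) + ∑ i : Fin M, (if (i : ℕ) < K then 0 else g i) =
      ∑ i, g i := by
  obtain ⟨r, rfl⟩ := Nat.exists_eq_add_of_le hKM
  rw [Fin.sum_univ_add, Fin.sum_univ_add]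
  have h1 : ∀ k : Fin K, Fin.castLE hKM k = Fin.castAdd r k := fun k => rfl
  simp [h1]

/-- The block of `V₁ᴴ V₂` formed by the trailing rows and the leading `K` columns, padded with
zeros. -/
noncomputable def trailingLeadingBlock (K : ℕ) (V₁ V₂ : Matrix (Fin M) (Fin M) ℂ) :
    Matrix (Fin M) (Fin M) ℂ :=
  Matrix.diagonal (fun i : Fin M => if (i : ℕ) < K then (0 : ℂ) else 1) * (V₁ᴴ * V₂) *
    Matrix.diagonal (fun i : Fin M => if (i : ℕ) < K then (1 : ℂ) else 0)

/-- Unitarity splits `‖z‖²` into the leading part `‖U₁ᴴ U₂ z‖²` and the trailing part, at most `‖X‖²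
‖z‖²`. So every cosine satisfies `σ_j² ≥ 1 - ‖X‖²`. -/
theorem subspaceDist_le_norm_trailingLeadingBlock (hKM : K ≤ M) {V₁ V₂ : Matrix (Fin M) (Fin M) ℂ}
    (h₁ : V₁ ∈ Matrix.unitaryGroup (Fin M) ℂ) (h₂ : V₂ ∈ Matrix.unitaryGroup (Fin M) ℂ)
    {U₁ U₂ : Matrix (Fin M) (Fin K) ℂ} (hU₁ : ∀ m k, U₁ m k = V₁ m (Fin.castLE hKM k))
    (hU₂ : ∀ m k, U₂ m k = V₂ m (Fin.castLE hKM k)) :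
    subspaceDist U₁ U₂ ≤ ‖trailingLeadingBlock K V₁ V₂‖ := by
  set X := trailingLeadingBlock K V₁ V₂ with hX
  have hQ : (V₂ᴴ * V₁) ∈ Matrix.unitaryGroup (Fin M) ℂ := mul_mem (Unitary.star_mem h₂) h₁
  have hlow : ∀ z : EuclideanSpace ℂ (Fin K),
      (1 - ‖X‖ ^ 2) * ‖z‖ ^ 2 ≤ ‖Matrix.toEuclideanLin (U₁ᴴ * U₂) z‖ ^ 2 := by
    intro z
    set z' : EuclideanSpace ℂ (Fin M) :=
      WithLp.toLp 2 fun i => if h : (i : ℕ) < K then z.ofLp ⟨i, h⟩ else 0 with hz'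
    have hz'c : ∀ k, z'.ofLp (Fin.castLE hKM k) = z.ofLp k := fun k => by simp [hz']
    have hz'n : ∀ i : Fin M, ¬ (i : ℕ) < K → z'.ofLp i = 0 := fun i hi => by simp [hz', hi]
    have hnorm : ‖z'‖ ^ 2 = ‖z‖ ^ 2 := by
      rw [EuclideanSpace.norm_sq_eq, EuclideanSpace.norm_sq_eq, ← sum_castLE_add_sum_ite hKM]
      simp_rw [hz'c]
      rw [add_eq_left]
      refine Finset.sum_eq_zero fun i _ => ?_
      split_ifs with h
      · rfl
      · simp [hz'n i h]
    have hUz : U₂ *ᵥ z.ofLp = V₂ *ᵥ z'.ofLp := by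
      obtain ⟨r, rfl⟩ := Nat.exists_eq_add_of_le hKM
      ext m
      rw [Matrix.mulVec, Matrix.mulVec, dotProduct, dotProduct, Fin.sum_univ_add]
      have h1 : ∀ k : Fin K, z'.ofLp (Fin.castAdd r k) = z.ofLp k := hz'c
      have h2 : ∀ k : Fin r, z'.ofLp (Fin.natAdd K k) = 0 := fun k => hz'n _ (by simp)
      simp only [h1, h2, mul_zero, Finset.sum_const_zero, add_zero, hU₂]
      rfl
    set w := (V₁ᴴ * V₂) *ᵥ z'.ofLp with hw
    have hC : ∀ k, (Matrix.toEuclideanLin (U₁ᴴ * U₂) z).ofLp k = w (Fin.castLE hKM k) := by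
      intro k
      change ((U₁ᴴ * U₂) *ᵥ z.ofLp) k = _
      rw [← Matrix.mulVec_mulVec, hUz, hw,
        ← Matrix.mulVec_mulVec]
      simp [Matrix.mulVec, dotProduct, hU₁]
    have hwn : ∑ i, ‖w i‖ ^ 2 = ‖z‖ ^ 2 := by
      have := sum_norm_sq_unitary_mulVec hQ z'
      rwa [Matrix.conjTranspose_mul, Matrix.conjTranspose_conjTranspose, hnorm] at this
    have hXz : ∀ i, (X *ᵥ z'.ofLp) i = if (i : ℕ) < K then 0 else w i := by
      intro i
      have hJ : Matrix.diagonal (fun i : Fin M => if (i : ℕ) < K then (1 : ℂ) else 0) *ᵥ z'.ofLp =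
          z'.ofLp := by
        ext j
        rw [Matrix.mulVec_diagonal]
        split_ifs with h
        · rw [one_mul]
        · rw [hz'n j h, mul_zero]
      rw [hX, trailingLeadingBlock, ← Matrix.mulVec_mulVec, hJ, ← Matrix.mulVec_mulVec,
        Matrix.mulVec_diagonal]
      split_ifs <;> simp [hw]
    have hXle : ∑ i : Fin M, (if (i : ℕ) < K then 0 else ‖w i‖ ^ 2) ≤ ‖X‖ ^ 2 * ‖z‖ ^ 2 := by
      have h1 := Matrix.l2_opNorm_mulVec X z'
      calc _ = ‖WithLp.toLp 2 (X *ᵥ z'.ofLp)‖ ^ 2 := by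
            rw [EuclideanSpace.norm_sq_eq]
            refine Finset.sum_congr rfl fun i _ => ?_
            simp only [hXz]
            split_ifs <;> simp
        _ ≤ (‖X‖ * ‖z'‖) ^ 2 := by gcongr; exact h1
        _ = _ := by rw [mul_pow, hnorm]
    have hsplit := sum_castLE_add_sum_ite hKM fun i => ‖w i‖ ^ 2
    rw [EuclideanSpace.norm_sq_eq (Matrix.toEuclideanLin (U₁ᴴ * U₂) z)]
    simp only [hC]
    linarith
  rw [subspaceDist, Matrix.l2_opNorm_diagonal, pi_norm_le_iff_of_nonneg (norm_nonneg _)]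
  intro j
  rw [canonicalAngle, Real.sin_arccos, Real.norm_of_nonneg (Real.sqrt_nonneg _)]
  have := LinearMap.le_sq_singularValues _ hlow (j := j) (by simp)
  rw [Real.sqrt_le_left (norm_nonneg _)]
  rw [singularValue]
  linarith

theorem norm_le_one_of_mem_unitaryGroup {V : Matrix (Fin M) (Fin M) ℂ}
    (hV : V ∈ Matrix.unitaryGroup (Fin M) ℂ) : ‖V‖ ≤ 1 := by
  have h : ‖V‖ ^ 2 = ‖(1 : Matrix (Fin M) (Fin M) ℂ)‖ := by
    rw [← Matrix.mem_unitaryGroup_iff'.mp hV, sq]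
    exact (Matrix.l2_opNorm_conjTranspose_mul_self V).symm
  have h1 : ‖(1 : Matrix (Fin M) (Fin M) ℂ)‖ ≤ 1 := by
    rw [← Matrix.diagonal_one, Matrix.l2_opNorm_diagonal]
    exact (pi_norm_le_iff_of_nonneg zero_le_one).mpr fun i => by simp
  nlinarith [norm_nonneg V]

theorem norm_diagonal_le_of_forall {d : Fin M → ℂ} {c : ℝ} (hc : 0 ≤ c) (h : ∀ i, ‖d i‖ ≤ c) :
    ‖Matrix.diagonal d‖ ≤ c := by
  rw [Matrix.l2_opNorm_diagonal]
  exact (pi_norm_le_iff_of_nonneg hc).mpr h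

/-- A Davis-Kahan bound for the trailing-leading block. -/
theorem norm_trailingLeadingBlock_mul_le {V₁ V₂ : Matrix (Fin M) (Fin M) ℂ}
    (h₁ : V₁ ∈ Matrix.unitaryGroup (Fin M) ℂ) (h₂ : V₂ ∈ Matrix.unitaryGroup (Fin M) ℂ)
    {ev₁ ev₂ : Fin M → ℝ} {R₁ R₂ : Matrix (Fin M) (Fin M) ℂ}
    (hR₁ : R₁ = V₁ * Matrix.diagonal (fun j => (ev₁ j : ℂ)) * V₁ᴴ)
    (hR₂ : R₂ = V₂ * Matrix.diagonal (fun j => (ev₂ j : ℂ)) * V₂ᴴ) {c l T : ℝ} (hl : 0 < l)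
    (hT : 0 ≤ T) (hΔ : ‖R₁ - R₂ - (c : ℂ) • (1 : Matrix (Fin M) (Fin M) ℂ)‖ ≤ T)
    (hev₁ : ∀ i : Fin M, ¬ (i : ℕ) < K → |ev₁ i - c| ≤ T)
    (hev₂ : ∀ i : Fin M, (i : ℕ) < K → l ≤ ev₂ i) :
    ‖trailingLeadingBlock K V₁ V₂‖ * (l - T) ≤ T := by
  set X := trailingLeadingBlock K V₁ V₂ with hX
  set Δ := R₁ - R₂ - (c : ℂ) • (1 : Matrix (Fin M) (Fin M) ℂ) with hΔdef
  set J' : Matrix (Fin M) (Fin M) ℂ := Matrix.diagonal fun i => if (i : ℕ) < K then 0 else 1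
    with hJ'
  set J : Matrix (Fin M) (Fin M) ℂ := Matrix.diagonal fun i => if (i : ℕ) < K then 1 else 0
    with hJ
  set D₁ : Matrix (Fin M) (Fin M) ℂ := Matrix.diagonal fun j => (ev₁ j : ℂ) with hD₁
  set D₂ : Matrix (Fin M) (Fin M) ℂ := Matrix.diagonal fun j => (ev₂ j : ℂ) with hD₂
  set Dc : Matrix (Fin M) (Fin M) ℂ :=
    Matrix.diagonal fun i => if (i : ℕ) < K then 0 else ((ev₁ i - c : ℝ) : ℂ) with hDc
  set Di : Matrix (Fin M) (Fin M) ℂ :=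
    Matrix.diagonal fun i => if (i : ℕ) < K then ((ev₂ i)⁻¹ : ℂ) else 0 with hDi
  have hJD : J * D₂ * Di = J := by
    rw [hJ, hD₂, hDi, Matrix.diagonal_mul_diagonal, Matrix.diagonal_mul_diagonal]
    congr 1
    ext i
    split_ifs with h
    · have : (ev₂ i : ℂ) ≠ 0 := by
        have := hev₂ i h
        exact_mod_cast (by linarith : (0 : ℝ) < ev₂ i).ne'
      field_simp
    · simp
  have hcomm : J * D₂ = D₂ * J := by
    rw [hJ, hD₂, Matrix.diagonal_mul_diagonal, Matrix.diagonal_mul_diagonal]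
    simp only [mul_comm]
  have hJ'D : J' * D₁ - (c : ℂ) • J' = Dc * J' := by
    rw [hJ', hD₁, hDc, Matrix.diagonal_mul_diagonal, Matrix.diagonal_mul_diagonal,
      ← Matrix.diagonal_smul, Matrix.diagonal_sub]
    congr 1
    ext i
    simp only [Pi.smul_apply, smul_eq_mul]
    split_ifs <;> simp
  have e₁ : V₁ᴴ * R₁ = D₁ * V₁ᴴ := by
    have : V₁ᴴ * V₁ = 1 := Matrix.mem_unitaryGroup_iff'.mp h₁
    rw [hR₁, ← Matrix.mul_assoc, ← Matrix.mul_assoc, this, Matrix.one_mul]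
  have e₂ : R₂ * V₂ = V₂ * D₂ := by
    have : V₂ᴴ * V₂ = 1 := Matrix.mem_unitaryGroup_iff'.mp h₂
    rw [hR₂, Matrix.mul_assoc, this, Matrix.mul_one]
  have hXdef : X = J' * (V₁ᴴ * V₂) * J := rfl
  -- The Sylvester equation for the block. The shift `c` is moved into `Dc`, which has norm at most
  -- `T`, while `D₂` is at least `l` on the leading columns and can be inverted there.
  have key : X * D₂ = Dc * X - J' * (V₁ᴴ * Δ * V₂) * J := by
    have h1 : V₁ᴴ * Δ * V₂ = D₁ * (V₁ᴴ * V₂) - V₁ᴴ * V₂ * D₂ - (c : ℂ) • (V₁ᴴ * V₂) := by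
      rw [hΔdef, Matrix.mul_sub, Matrix.mul_sub, Matrix.sub_mul, Matrix.sub_mul, e₁,
        Matrix.mul_assoc _ R₂, e₂, Matrix.mul_smul, Matrix.mul_one, Matrix.smul_mul,
        Matrix.mul_assoc, Matrix.mul_assoc]
    have h2 : Dc * X = (J' * D₁ - (c : ℂ) • J') * (V₁ᴴ * V₂) * J := by
      rw [hJ'D, hXdef]
      simp only [Matrix.mul_assoc]
    rw [h1, h2, hXdef, Matrix.mul_assoc _ J, hcomm]
    simp only [Matrix.mul_sub, Matrix.sub_mul, Matrix.mul_smul, Matrix.smul_mul, Matrix.mul_assoc]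
    abel
  have hXX : X = (Dc * X - J' * (V₁ᴴ * Δ * V₂) * J) * Di := by
    rw [← key, hXdef, Matrix.mul_assoc _ J, Matrix.mul_assoc _ (J * D₂), hJD]
  have nJ' : ‖J'‖ ≤ 1 := norm_diagonal_le_of_forall zero_le_one fun i => by split_ifs <;> simp
  have nJ : ‖J‖ ≤ 1 := norm_diagonal_le_of_forall zero_le_one fun i => by split_ifs <;> simp
  have nDc : ‖Dc‖ ≤ T := norm_diagonal_le_of_forall hT fun i => by
    split_ifs with h
    · simpa using hT
    · rw [Complex.norm_real]
      exact hev₁ i h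
  have nDi : ‖Di‖ ≤ l⁻¹ := norm_diagonal_le_of_forall (by positivity) fun i => by
    split_ifs with h
    · rw [← Complex.ofReal_inv, Complex.norm_real, Real.norm_of_nonneg
        (inv_nonneg.mpr (hl.le.trans (hev₂ i h)))]
      exact inv_anti₀ hl (hev₂ i h)
    · simpa using hl.le
  have nV₁ : ‖V₁ᴴ‖ ≤ 1 := norm_le_one_of_mem_unitaryGroup (Unitary.star_mem h₁)
  have nV₂ : ‖V₂‖ ≤ 1 := norm_le_one_of_mem_unitaryGroup h₂
  have n1 : ‖J' * (V₁ᴴ * Δ * V₂) * J‖ ≤ T := by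
    calc _ ≤ ‖J'‖ * (‖V₁ᴴ‖ * ‖Δ‖ * ‖V₂‖) * ‖J‖ := by
          refine (Matrix.l2_opNorm_mul _ _).trans ?_
          gcongr
          refine (Matrix.l2_opNorm_mul _ _).trans ?_
          gcongr
          refine (Matrix.l2_opNorm_mul _ _).trans ?_
          gcongr
          exact Matrix.l2_opNorm_mul _ _
      _ ≤ 1 * (1 * T * 1) * 1 := by gcongr
      _ = T := by ring
  have n2 : ‖X‖ ≤ (T * ‖X‖ + T) * l⁻¹ := by
    calc ‖X‖ = ‖(Dc * X - J' * (V₁ᴴ * Δ * V₂) * J) * Di‖ := congrArg norm hXX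
      _ ≤ ‖Dc * X - J' * (V₁ᴴ * Δ * V₂) * J‖ * ‖Di‖ := Matrix.l2_opNorm_mul _ _
      _ ≤ (‖Dc‖ * ‖X‖ + T) * l⁻¹ := by
          gcongr
          refine (norm_sub_le _ _).trans ?_
          gcongr
          exact Matrix.l2_opNorm_mul _ _
      _ ≤ _ := by gcongr
  rw [← div_eq_mul_inv, le_div_iff₀ hl] at n2
  linarith

end DavisKahan

/-! ### Structure of the smoothed covariance and the deterministic perturbation bound. -/

section Steering

open Module

variable {N M P K L : ℕ}

/-- Distinct points of `[0, 1)` give distinct nodes on the unit circle, and the first `K` rows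
already form an invertible Vandermonde matrix. -/
theorem steering_injective {f : Fin K → ℝ} (hf : ∀ k, f k ∈ Set.Ico (0 : ℝ) 1)
    (hf_inj : Function.Injective f) (hKM : K ≤ M) :
    Function.Injective (Matrix.toEuclideanLin (steering f M)) := by
  have hx : Function.Injective fun k => Complex.exp (2 * Real.pi * Complex.I * (f k : ℂ)) := by
    intro j k hjk
    obtain ⟨n, hn⟩ := Complex.exp_eq_exp_iff_exists_int.mp hjk
    have hn' : (f j : ℂ) = f k + n := by
      have h2 : (2 * Real.pi * Complex.I : ℂ) ≠ 0 := Complex.two_pi_I_ne_zero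
      apply mul_left_cancel₀ h2
      rw [hn]
      ring
    have hn'' : f j = f k + n := by exact_mod_cast hn'
    have h0 : n = 0 := by
      have h1 : (n : ℝ) < 1 := by linarith [(hf j).2, (hf k).1]
      have h2 : (-1 : ℝ) < n := by linarith [(hf k).2, (hf j).1]
      have h1' : n < 1 := by exact_mod_cast h1
      have h2' : -1 < n := by exact_mod_cast h2
      omega
    exact hf_inj (by simpa [h0] using hn'')
  rw [← LinearMap.ker_eq_bot, LinearMap.ker_eq_bot']
  intro z hz
  have hz' : steering f M *ᵥ z.ofLp = 0 := congrArg WithLp.ofLp hz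
  have h0 : z.ofLp = 0 := by
    refine Matrix.eq_zero_of_forall_pow_sum_mul_pow_eq_zero hx fun i => ?_
    have := congrFun hz' (Fin.castLE hKM i)
    refine Eq.trans ?_ this
    rw [Matrix.mulVec, dotProduct]
    refine Finset.sum_congr rfl fun k _ => ?_
    rw [← Complex.exp_nat_mul, mul_comm]
    simp only [steering, Matrix.of_apply, Fin.val_castLE]
    ring_nf
  ext i
  exact congrFun h0 i

/-- The phase shifts of the `p`-th subarray relative to the first one. -/
noncomputable def phaseShift (f : Fin K → ℝ) (p : ℕ) : Fin K → ℂ :=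
  fun k => Complex.exp (2 * Real.pi * Complex.I * p * (f k : ℂ))

theorem subarray_steering_mul (hN : N + 1 = M + P) (f : Fin K → ℝ) (S : Matrix (Fin K) (Fin L) ℂ)
    (p : Fin P) : subarray hN (steering f N * S) p =
      steering f M * (Matrix.diagonal (phaseShift f p) * S) := by
  ext m l
  simp only [subarray, Matrix.of_apply]
  rw [Matrix.mul_apply, Matrix.mul_apply]
  refine Finset.sum_congr rfl fun k _ => ?_
  rw [Matrix.diagonal_mul]
  simp only [steering, phaseShift, Matrix.of_apply]
  rw [← mul_assoc, ← Complex.exp_add]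
  push_cast
  ring_nf

theorem norm_phaseShift (f : Fin K → ℝ) (p : ℕ) (k : Fin K) : ‖phaseShift f p k‖ = 1 := by
  rw [phaseShift, Complex.norm_exp]
  simp

theorem norm_subarray_steering_mul_le (hN : N + 1 = M + P) (f : Fin K → ℝ)
    (S : Matrix (Fin K) (Fin L) ℂ) (p : Fin P) :
    ‖subarray hN (steering f N * S) p‖ ≤ ‖steering f M‖ * ‖S‖ := by
  rw [subarray_steering_mul]
  refine (Matrix.l2_opNorm_mul _ _).trans ?_
  gcongr
  refine (Matrix.l2_opNorm_mul _ _).trans (mul_le_of_le_one_left (norm_nonneg _) ?_)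
  exact norm_diagonal_le_of_forall zero_le_one fun k => (norm_phaseShift f p k).le

/-- Conjugating a matrix by a diagonal of phases is a Hadamard product with a rank-one matrix;
averaging these over `p` gives `C_P`, whose conjugation puts the phases on the correct side. -/
theorem smoothedSourceCov_eq_sum (f : Fin K → ℝ) (S : Matrix (Fin K) (Fin L) ℂ) :
    smoothedSourceCov f P S = (1 / (P : ℂ)) • ∑ p : Fin P, (1 / (L : ℂ)) •
      ((Matrix.diagonal (phaseShift f p) * S) * (Matrix.diagonal (phaseShift f p) * S)ᴴ) := by
  have h : ∀ (p : Fin P) (j k : Fin K), ((Matrix.diagonal (phaseShift f p) * S) *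
      (Matrix.diagonal (phaseShift f p) * S)ᴴ) j k =
      phaseShift f p j * (S * Sᴴ) j k * conj (phaseShift f p k) := by
    intro p j k
    rw [Matrix.conjTranspose_mul, Matrix.diagonal_conjTranspose, Matrix.mul_assoc,
      ← Matrix.mul_assoc S, Matrix.diagonal_mul, Matrix.mul_diagonal, ← mul_assoc]
    rfl
  ext j k
  simp only [smoothedSourceCov, sourceCov, corr, Matrix.hadamard_apply, Matrix.smul_apply,
    Matrix.sum_apply, smul_eq_mul, Matrix.map_apply, h]
  rw [Matrix.mul_apply (M := (steering f P)ᴴ), map_sum, Finset.mul_sum, Finset.mul_sum,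
    Finset.mul_sum]
  refine Finset.sum_congr rfl fun p _ => ?_
  rw [map_mul, Matrix.conjTranspose_apply, RCLike.star_def, Complex.conj_conj]
  simp only [steering, phaseShift, Matrix.of_apply]
  ring

theorem smoothedCov_steering_mul (hN : N + 1 = M + P) (f : Fin K → ℝ)
    (S : Matrix (Fin K) (Fin L) ℂ) : smoothedCov hN (steering f N * S) =
      steering f M * smoothedSourceCov f P S * (steering f M)ᴴ := by
  rw [smoothedSourceCov_eq_sum, smoothedCov]
  simp only [subarray_steering_mul, Matrix.mul_smul, Matrix.smul_mul, Matrix.mul_sum,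
    Matrix.sum_mul, Matrix.conjTranspose_mul, Matrix.mul_assoc]

theorem subarray_add (hN : N + 1 = M + P) (Y E : Matrix (Fin N) (Fin L) ℂ) (p : Fin P) :
    subarray hN (Y + E) p = subarray hN Y p + subarray hN E p := rfl

theorem norm_smoothedCov_add_sub_le (hN : N + 1 = M + P) (hP : 0 < P) (hL : 0 < L)
    (Y E : Matrix (Fin N) (Fin L) ℂ) {v c₁ c₂ : ℝ}
    (h₁ : ∀ p, ‖subarray hN Y p * (subarray hN E p)ᴴ + subarray hN E p * (subarray hN Y p)ᴴ‖ ≤ c₁)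
    (h₂ : ∀ p, ‖subarray hN E p * (subarray hN E p)ᴴ -
      ((v * L : ℝ) : ℂ) • (1 : Matrix (Fin M) (Fin M) ℂ)‖ ≤ c₂) :
    ‖smoothedCov hN (Y + E) - smoothedCov hN Y - (v : ℂ) • (1 : Matrix (Fin M) (Fin M) ℂ)‖ ≤
      (c₁ + c₂) / L := by
  have hP' : (0 : ℝ) < P := by exact_mod_cast hP
  have hL' : (0 : ℝ) < L := by exact_mod_cast hL
  have hPc : (P : ℂ) ≠ 0 := by exact_mod_cast hP.ne'
  have hLc : (L : ℂ) ≠ 0 := by exact_mod_cast hL.ne'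
  set D : Fin P → Matrix (Fin M) (Fin M) ℂ := fun p =>
    (subarray hN Y p * (subarray hN E p)ᴴ + subarray hN E p * (subarray hN Y p)ᴴ) +
      (subarray hN E p * (subarray hN E p)ᴴ - ((v * L : ℝ) : ℂ) • 1) with hD
  have e : smoothedCov hN (Y + E) - smoothedCov hN Y - (v : ℂ) • (1 : Matrix (Fin M) (Fin M) ℂ) =
      (1 / (P : ℂ)) • ∑ p : Fin P, (1 / (L : ℂ)) • D p := by
    have h1 : (v : ℂ) • (1 : Matrix (Fin M) (Fin M) ℂ) =
        (1 / (P : ℂ)) • ∑ _p : Fin P, (1 / (L : ℂ)) • (((v * L : ℝ) : ℂ) • 1) := by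
      rw [Finset.sum_const, Finset.card_univ, Fintype.card_fin, ← Nat.cast_smul_eq_nsmul ℂ,
        smul_smul, smul_smul, smul_smul]
      congr 1
      push_cast
      field_simp
    rw [smoothedCov, smoothedCov, h1, ← smul_sub, ← smul_sub, ← Finset.sum_sub_distrib,
      ← Finset.sum_sub_distrib]
    congr 1
    refine Finset.sum_congr rfl fun p _ => ?_
    simp only [hD]
    rw [← smul_sub, ← smul_sub, subarray_add, Matrix.conjTranspose_add, Matrix.add_mul,
      Matrix.mul_add, Matrix.mul_add]
    congr 1
    abel
  rw [e, norm_smul]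
  calc _ ≤ ‖(1 / (P : ℂ))‖ * ∑ _p : Fin P, ‖(1 / (L : ℂ))‖ * (c₁ + c₂) := by
        gcongr
        refine (norm_sum_le _ _).trans (Finset.sum_le_sum fun p _ => ?_)
        rw [norm_smul]
        gcongr
        exact (norm_add_le _ _).trans (add_le_add (h₁ p) (h₂ p))
    _ = (c₁ + c₂) / L := by
        rw [Finset.sum_const, Finset.card_univ, Fintype.card_fin, nsmul_eq_mul]
        simp only [one_div, norm_inv, Complex.norm_natCast]
        field_simp

theorem sqrt_norm_sourceCov (S : Matrix (Fin K) (Fin L) ℂ) :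
    √‖sourceCov S‖ = ‖S‖ / √L := by
  have h : ‖S * Sᴴ‖ = ‖S‖ * ‖S‖ := by
    have := Matrix.l2_opNorm_conjTranspose_mul_self Sᴴ
    rwa [Matrix.conjTranspose_conjTranspose, Matrix.l2_opNorm_conjTranspose] at this
  rw [sourceCov, norm_smul, h, one_div, norm_inv, Complex.norm_natCast, ← div_eq_inv_mul,
    Real.sqrt_div (by positivity), Real.sqrt_mul_self (norm_nonneg _)]

theorem hermForm_mul_mul_conjTranspose (A : Matrix (Fin M) (Fin K) ℂ)
    (H : Matrix (Fin K) (Fin K) ℂ) (x : EuclideanSpace ℂ (Fin M)) :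
    hermForm (A * H * Aᴴ) x = hermForm H (WithLp.toLp 2 (Aᴴ *ᵥ x.ofLp)) := by
  have : star x.ofLp ᵥ* A = star (Aᴴ *ᵥ x.ofLp) := by
    rw [Matrix.star_mulVec, Matrix.conjTranspose_conjTranspose]
  rw [hermForm, hermForm, ← Matrix.mulVec_mulVec, ← Matrix.mulVec_mulVec, Matrix.dotProduct_mulVec,
    this]

/-- Perturbation bound for the leading eigenvectors of `A H Aᴴ` with `A` of full column rank and
`H` positive definite; the perturbation is measured up to a multiple of the identity. -/
theorem subspaceDist_mul_le (hK : 0 < K) (hKM : K ≤ M) {A : Matrix (Fin M) (Fin K) ℂ}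
    (hA : Function.Injective (Matrix.toEuclideanLin A)) {H : Matrix (Fin K) (Fin K) ℂ}
    (hH : H.PosDef) {R : Matrix (Fin M) (Fin M) ℂ} {c T : ℝ} (hT : 0 ≤ T)
    (hR : ‖R - A * H * Aᴴ - (c : ℂ) • (1 : Matrix (Fin M) (Fin M) ℂ)‖ ≤ T)
    {U Uhat : Matrix (Fin M) (Fin K) ℂ} (hU : IsLeadingEigenvectors hKM (A * H * Aᴴ) U)
    (hUhat : IsLeadingEigenvectors hKM R Uhat)
    (hTl : T < singularValue A (K - 1) ^ 2 *
      sortedEigenvalue hH.isHermitian ⟨K - 1, Nat.sub_lt hK one_pos⟩) :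
    subspaceDist Uhat U * (singularValue A (K - 1) ^ 2 *
      sortedEigenvalue hH.isHermitian ⟨K - 1, Nat.sub_lt hK one_pos⟩ - T) ≤ T := by
  obtain ⟨V₂, hV₂, ev₂, hev₂, hR₂, hU₂⟩ := hU
  obtain ⟨V₁, hV₁, ev₁, hev₁, hR₁, hU₁⟩ := hUhat
  set l := sortedEigenvalue hH.isHermitian ⟨K - 1, Nat.sub_lt hK one_pos⟩ with hldef
  set s := singularValue A (K - 1) with hsdef
  have hl : 0 < l := sortedEigenvalue_pos hH _
  set Δ := R - A * H * Aᴴ - (c : ℂ) • (1 : Matrix (Fin M) (Fin M) ℂ) with hΔ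
  have hform : ∀ x, hermForm R x = hermForm (A * H * Aᴴ) x + c * ‖x‖ ^ 2 + hermForm Δ x := by
    intro x
    have h1 : star x.ofLp ⬝ᵥ x.ofLp = ((‖x‖ ^ 2 : ℝ) : ℂ) := by
      rw [dotProduct_comm, ← EuclideanSpace.inner_eq_star_dotProduct, inner_self_eq_norm_sq_to_K]
      simp
    rw [hΔ, hermForm, hermForm, hermForm, Matrix.sub_mulVec, Matrix.sub_mulVec, dotProduct_sub,
      dotProduct_sub, Matrix.smul_mulVec, Matrix.one_mulVec, dotProduct_smul, h1, smul_eq_mul,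
      ← Complex.ofReal_mul, Complex.sub_re, Complex.sub_re, Complex.ofReal_re]
    ring
  have hΔx : ∀ x, |hermForm Δ x| ≤ T * ‖x‖ ^ 2 := fun x =>
    (abs_hermForm_le Δ x).trans (by gcongr)
  have hHx : ∀ z, l * ‖z‖ ^ 2 ≤ hermForm H z :=
    sortedEigenvalue_last_mul_norm_sq_le hH.isHermitian hK
  have hadj : ∀ x, LinearMap.adjoint (Matrix.toEuclideanLin A) x =
      WithLp.toLp 2 (Aᴴ *ᵥ x.ofLp) := fun x => by
    rw [← Matrix.toEuclideanLin_conjTranspose_eq_adjoint]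
    rfl
  -- The test space is the range of `A`, of dimension `K` by injectivity.
  have hlead : ∀ i : Fin M, (i : ℕ) < K → s ^ 2 * l ≤ ev₂ i := by
    intro i hi
    refine le_eigenvalue_of_le_hermForm hV₂ hev₂ (LinearMap.range (Matrix.toEuclideanLin A))
      (fun x hx => ?_) i ?_
    · obtain ⟨z, rfl⟩ := hx
      rw [← hR₂, hermForm_mul_mul_conjTranspose, ← hadj]
      have h1 := LinearMap.sq_singularValues_mul_norm_sq_le (Matrix.toEuclideanLin A)
        (finrank_euclideanSpace_fin (n := K)) z
      refine le_trans ?_ (hHx _)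
      calc _ = l * (s ^ 2 * ‖Matrix.toEuclideanLin A z‖ ^ 2) := by ring
        _ ≤ _ := by gcongr; exact h1
    · rw [LinearMap.finrank_range_of_inj hA, finrank_euclideanSpace_fin]
      exact hi
  -- Below, `A H Aᴴ ≥ 0` on the whole space suffices; above, the form of `A H Aᴴ` vanishes on `ker
  -- Aᴴ`, of dimension at least `M - K`.
  have htrail : ∀ i : Fin M, ¬ (i : ℕ) < K → |ev₁ i - c| ≤ T := by
    intro i hi
    rw [abs_le]
    constructor
    · have : c - T ≤ ev₁ i := by
        refine le_eigenvalue_of_le_hermForm hV₁ hev₁ ⊤ (fun x _ => ?_) i (by simp)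
        rw [← hR₁, hform, hermForm_mul_mul_conjTranspose]
        have h1 := (abs_le.mp (hΔx x)).1
        have h2 : 0 ≤ hermForm H (WithLp.toLp 2 (Aᴴ *ᵥ x.ofLp)) :=
          le_trans (by positivity) (hHx _)
        linarith
      linarith
    · have : ev₁ i ≤ c + T := by
        refine eigenvalue_le_of_hermForm_le hV₁ hev₁
          (LinearMap.ker (LinearMap.adjoint (Matrix.toEuclideanLin A))) (fun x hx => ?_) i ?_
        · rw [← hR₁, hform, hermForm_mul_mul_conjTranspose, ← hadj, LinearMap.mem_ker.mp hx]
          have h1 := (abs_le.mp (hΔx x)).2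
          have h2 : hermForm H 0 = 0 := by simp [hermForm]
          rw [h2]
          linarith
        · have h1 := LinearMap.finrank_range_add_finrank_ker
            (LinearMap.adjoint (Matrix.toEuclideanLin A))
          have h2 := Submodule.finrank_le
            (LinearMap.range (LinearMap.adjoint (Matrix.toEuclideanLin A)))
          rw [finrank_euclideanSpace_fin] at h1 h2
          omega
      linarith
  have hX := norm_trailingLeadingBlock_mul_le (K := K) hV₁ hV₂ hR₁ hR₂ (hT.trans_lt hTl) hT hR
    htrail hlead
  refine le_trans ?_ hX
  have : 0 ≤ s ^ 2 * l - T := by linarith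
  gcongr
  exact subspaceDist_le_norm_trailingLeadingBlock hKM hV₁ hV₂ hU₁ hU₂

end Steering

/-! ### The exceptional event for one subarray and the union over all of them. -/

section GoodEvent

variable {Ω : Type*} [MeasurableSpace Ω] {μ : Measure Ω} [IsProbabilityMeasure μ]
  {N M P L : ℕ}

theorem measure_cross_or_noise_gt_le (hM : 0 < M) (hL : 0 < L) {v : ℝ} (hv : 0 ≤ v)
    {X : Ω → Matrix (Fin M) (Fin L) ℂ}
    (hX : iIndepFun (fun (i : Fin M × Fin L) (ω : Ω) => X ω i.1 i.2) μ)
    (hlaw : ∀ i j, HasLaw (fun ω => X ω i j) (complexGaussian v) μ)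
    (B : Matrix (Fin M) (Fin L) ℂ) :
    μ {ω | 15 / 2 * (‖B‖ * √v * √M) < ‖B * (X ω)ᴴ + X ω * Bᴴ‖ ∨
        10 * v * L * max (√((M : ℝ) / L)) ((M : ℝ) / L) <
          ‖X ω * (X ω)ᴴ - ((v * L : ℝ) : ℂ) • (1 : Matrix (Fin M) (Fin M) ℂ)‖} ≤
      ENNReal.ofReal (3 * Real.exp (-(M : ℝ) / 2)) := by
  have hae : ∀ i j, AEMeasurable (fun ω => X ω i j) μ := fun i j => (hlaw i j).aemeasurable
  -- `HasLaw` provides only a.e. measurability, so the entries are replaced by measurable versions.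
  obtain ⟨X', hm, heq⟩ : ∃ X' : Ω → Matrix (Fin M) (Fin L) ℂ,
      (∀ i j, Measurable fun ω => X' ω i j) ∧
        ∀ i j, (fun ω => X ω i j) =ᵐ[μ] fun ω => X' ω i j :=
    ⟨fun ω => Matrix.of fun i j => (hae i j).mk _ ω, fun i j => (hae i j).measurable_mk,
      fun i j => (hae i j).ae_eq_mk⟩
  have hXX' : ∀ᵐ ω ∂μ, X ω = X' ω := by
    filter_upwards [ae_all_iff.mpr fun i => ae_all_iff.mpr fun j => heq i j] with ω hω
    ext i j
    exact hω i j
  have hind : iIndepFun (fun (i : Fin M × Fin L) (ω : Ω) => X' ω i.1 i.2) μ :=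
    (iIndepFun_congr fun i : Fin M × Fin L => heq i.1 i.2).mp hX
  have hlaw' : ∀ i j, HasLaw (fun ω => X' ω i j) (complexGaussian v) μ := fun i j =>
    (hlaw i j).congr (heq i j).symm
  have h₁ := measure_lt_norm_mul_conjTranspose_add_le hM hv hm hind hlaw' B
  have h₂ := measure_lt_norm_mul_conjTranspose_sub_le hM hL hv hm hind hlaw'
  refine (measure_mono_ae ?_).trans ((measure_union_le _ _).trans ((add_le_add h₁ h₂).trans
    (le_of_eq ?_)))
  · filter_upwards [hXX'] with ω hω h
    change _ < _ ∨ _ < _ at h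
    rw [hω] at h
    exact h
  · rw [← ENNReal.ofReal_add (by positivity) (by positivity)]
    ring_nf

theorem measure_not_forall_subarray_le (hM : 0 < M) (hL : 0 < L) (hN : N + 1 = M + P) {v : ℝ}
    (hv : 0 ≤ v) {E : Ω → Matrix (Fin N) (Fin L) ℂ}
    (hE_indep : iIndepFun (fun (i : Fin N × Fin L) (ω : Ω) => E ω i.1 i.2) μ)
    (hE_law : ∀ n l, HasLaw (fun ω => E ω n l) (complexGaussian v) μ)
    (Y : Matrix (Fin N) (Fin L) ℂ) :
    μ {ω | ¬ ∀ p, ‖subarray hN Y p * (subarray hN (E ω) p)ᴴ +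
            subarray hN (E ω) p * (subarray hN Y p)ᴴ‖ ≤
          15 / 2 * (‖subarray hN Y p‖ * √v * √M) ∧
        ‖subarray hN (E ω) p * (subarray hN (E ω) p)ᴴ -
            ((v * L : ℝ) : ℂ) • (1 : Matrix (Fin M) (Fin M) ℂ)‖ ≤
          10 * v * L * max (√((M : ℝ) / L)) ((M : ℝ) / L)} ≤
      ENNReal.ofReal (3 * P * Real.exp (-(M : ℝ) / 2)) := by
  have hsi : ∀ p : Fin P,
      iIndepFun (fun (q : Fin M × Fin L) ω => subarray hN (E ω) p q.1 q.2) μ := fun p =>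
    hE_indep.precomp (g := fun q : Fin M × Fin L =>
      ((⟨(p : ℕ) + (q.1 : ℕ), by omega⟩ : Fin N), q.2)) fun a b h => by
        have h1 := congrArg (fun q : Fin N × Fin L => (q.1 : ℕ)) h
        have h2 := congrArg (fun q : Fin N × Fin L => q.2) h
        exact Prod.ext (Fin.ext (Nat.add_left_cancel h1)) h2
  have hsl : ∀ (p : Fin P) i j, HasLaw (fun ω => subarray hN (E ω) p i j) (complexGaussian v) μ :=
    fun p i j => hE_law ⟨(p : ℕ) + (i : ℕ), by omega⟩ j
  have h := fun p => measure_cross_or_noise_gt_le hM hL hv (hsi p) (hsl p) (subarray hN Y p)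
  refine (measure_mono fun ω hω => ?_).trans ((measure_iUnion_fintype_le _ _).trans
    ((Finset.sum_le_sum fun p _ => h p).trans (le_of_eq ?_)))
  · obtain ⟨p, hp⟩ := not_forall.mp hω
    rw [not_and_or, not_le, not_le] at hp
    exact Set.mem_iUnion.mpr ⟨p, hp⟩
  · rw [Finset.sum_const, Finset.card_univ, Fintype.card_fin, nsmul_eq_mul,
      ← ENNReal.ofReal_natCast, ← ENNReal.ofReal_mul (by positivity)]
    ring_nf

end GoodEvent

/-! ### Assembly of the probabilistic and deterministic bounds. -/

theorem theorem10 {Ω : Type*} [MeasurableSpace Ω] (μ : Measure Ω) [IsProbabilityMeasure μ]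
    {N M P K L : ℕ} (hK : 0 < K) (hKM : K ≤ M) (hP : 0 < P) (hL : 0 < L)
    (hN : N + 1 = M + P)
    -- distinct frequencies in [0, 1)
    (f : Fin K → ℝ) (hf : ∀ k, f k ∈ Set.Ico (0 : ℝ) 1) (hf_inj : Function.Injective f)
    -- the source signals and the noise
    (S : Matrix (Fin K) (Fin L) ℂ) (σ : ℝ) (hσ : 0 ≤ σ)
    (E : Ω → Matrix (Fin N) (Fin L) ℂ)
    (hE_indep : iIndepFun (fun (i : Fin N × Fin L) (ω : Ω) => E ω i.1 i.2) μ)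
    (hE_law : ∀ n l, HasLaw (fun ω => E ω n l) (complexGaussian (σ ^ 2)) μ)
    (hS : (smoothedSourceCov f P S).PosDef)
    (hbound : errorBound hK f S σ M P hS < 0.586) :
    ∃ G : Set Ω, MeasurableSet G ∧
      ENNReal.ofReal (1 - 3 * P * Real.exp (-(M : ℝ) / 2)) ≤ μ G ∧
      ∀ ω ∈ G, ∀ U Uhat : Matrix (Fin M) (Fin K) ℂ,
        IsLeadingEigenvectors hKM (smoothedCov hN (steering f N * S)) U →
        IsLeadingEigenvectors hKM (smoothedCov hN (steering f N * S + E ω)) Uhat →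
        subspaceDist Uhat U ≤ errorBound hK f S σ M P hS := by
  have hM : 0 < M := hK.trans_le hKM
  have hL' : (0 : ℝ) < L := by exact_mod_cast hL
  have hA := steering_injective hf hf_inj hKM
  set l := sortedEigenvalue hS.isHermitian ⟨K - 1, Nat.sub_lt hK one_pos⟩ with hl
  set s := singularValue (steering f M) (K - 1) with hs
  have hsl : 0 < s ^ 2 * l := by
    have h1 : 0 < l := sortedEigenvalue_pos hS _
    have h2 : 0 < s := (LinearMap.injective_iff_forall_lt_finrank_singularValues_pos _).mp hA
      (K - 1) (by rw [finrank_euclideanSpace_fin]; omega)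
    positivity
  set B := errorBound hK f S σ M P hS with hB
  set c₁ : ℝ := 15 / 2 * (‖steering f M‖ * ‖S‖ * σ * √M) with hc₁
  set c₂ : ℝ := 10 * σ ^ 2 * L * max (√((M : ℝ) / L)) ((M : ℝ) / L) with hc₂
  -- The tail constants `15/2` and `10` are both `5/8` of the constants `12` and `16` in the error
  -- bound.
  have hT : (c₁ + c₂) / L = 5 / 8 * (B * (s ^ 2 * l)) := by
    have h1 : B * (s ^ 2 * l) = 12 * σ * ‖steering f M‖ * (‖S‖ / √L) * (√M / √L)
        + 16 * σ ^ 2 * max (√((M : ℝ) / L)) ((M : ℝ) / L) := by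
      rw [hB, errorBound, div_mul_cancel₀ _ hsl.ne', sqrt_norm_sourceCov,
        ← Real.sqrt_div (Nat.cast_nonneg M)]
    have h2 : √(L : ℝ) * √L = L := Real.mul_self_sqrt hL'.le
    have h3 : 12 * σ * ‖steering f M‖ * (‖S‖ / √L) * (√M / √L) =
        12 * σ * ‖steering f M‖ * ‖S‖ * √M / L := by
      rw [mul_assoc _ (‖S‖ / √L), div_mul_div_comm, h2]
      ring
    rw [h1, h3, hc₁, hc₂]
    field_simp
    ring
  have hT0 : 0 ≤ (c₁ + c₂) / L := by positivity
  set bad : Set Ω := {ω | ¬ ∀ p, ‖subarray hN (steering f N * S) p * (subarray hN (E ω) p)ᴴ +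
            subarray hN (E ω) p * (subarray hN (steering f N * S) p)ᴴ‖ ≤
          15 / 2 * (‖subarray hN (steering f N * S) p‖ * √(σ ^ 2) * √M) ∧
        ‖subarray hN (E ω) p * (subarray hN (E ω) p)ᴴ -
            ((σ ^ 2 * L : ℝ) : ℂ) • (1 : Matrix (Fin M) (Fin M) ℂ)‖ ≤ c₂} with hbad
  have hμ : μ bad ≤ ENNReal.ofReal (3 * P * Real.exp (-(M : ℝ) / 2)) :=
    measure_not_forall_subarray_le hM hL hN (sq_nonneg σ) hE_indep hE_law _
  -- The bad set need not be measurable; its measurable hull has the same measure.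
  refine ⟨(toMeasurable μ bad)ᶜ, (measurableSet_toMeasurable μ bad).compl, ?_, ?_⟩
  · rw [prob_compl_eq_one_sub (measurableSet_toMeasurable μ bad), measure_toMeasurable,
      ENNReal.ofReal_sub _ (by positivity), ENNReal.ofReal_one]
    gcongr
  · intro ω hω U Uhat hU hUhat
    have hgood : ω ∉ bad := fun h => hω (subset_toMeasurable μ bad h)
    rw [hbad, Set.mem_ofPred_eq, not_not] at hgood
    have hΔ := norm_smoothedCov_add_sub_le hN hP hL (steering f N * S) (E ω) (v := σ ^ 2)
      (c₁ := c₁) (c₂ := c₂) (fun p => (hgood p).1.trans ?_) (fun p => (hgood p).2)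
    · rw [smoothedCov_steering_mul] at hΔ hU
      have hBl : B * (s ^ 2 * l) < 0.586 * (s ^ 2 * l) := by gcongr
      have hmain := subspaceDist_mul_le hK hKM hA hS hT0 hΔ hU hUhat (by
        rw [hT]
        norm_num at hBl
        linarith)
      rw [← hl, ← hs, hT] at hmain
      -- This amounts to `B ≤ 3/5`, which `B < 0.586` ensures.
      have h5 : 5 / 8 * (s ^ 2 * l) ≤ s ^ 2 * l - 5 / 8 * (B * (s ^ 2 * l)) := by
        norm_num at hBl
        linarith
      have hd : 0 ≤ subspaceDist Uhat U := norm_nonneg _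
      have h6 : subspaceDist Uhat U * (5 / 8 * (s ^ 2 * l)) ≤ B * (5 / 8 * (s ^ 2 * l)) :=
        (mul_le_mul_of_nonneg_left h5 hd).trans (hmain.trans (le_of_eq (by ring)))
      exact le_of_mul_le_mul_right h6 (by positivity)
    · rw [Real.sqrt_sq hσ, hc₁]
      gcongr
      exact norm_subarray_steering_mul_le hN f S p
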